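/- Let $\theta_a,\theta_b\in(-\frac{\pi}{2},\frac{\pi}{2})$. Let $S$ be the Fibonacci substitution $a\mapsto ab$, $b\mapsto a$, let $u=abaababa\ldots$ be its one-sided fixed point (the limit of the words $S^k(a)$), and let $\Omega$ be the set of all $\omega\in\{a,b\}^{\mathbb Z}$ all of whose finite subwords occur in $u$. For $\omega\in\Omega$ put $\alpha_{\omega,2n}=\sin\theta_{\omega_n}$ and $\alpha_{\omega,2n+1}=0$ $(n\in\mathbb Z)$, let $\mathcal E_\omega$ be the extended CMV matrix on $\ell^2(\mathbb Z)$ with Verblunsky coefficients $(\alpha_{\omega,n})_{n\in\mathbb Z}$, and let $\Sigma\subset\partial\mathbb D$ be its spectrum, which does not depend on $\omega\in\Omega$. For $z\in\partial\mathbb D$ and $|\alpha|<1$ let $$T(z,\alpha)=(1-|\alpha|^2)^{-1/2}\begin{pmatrix} z&-\bar\alpha\\-\alpha z&1\end{pmatrix},\qquad T_n(z;\omega)=T(z,\alpha_{\omega,n-1})\cdots T(z,\alpha_{\omega,0}).$$ A normalized solution at $z$ for $\omega$ is a pair of sequences with $\binom{\xi_n}{\zeta_n}=T_n(z;\omega)\binom{\xi_0}{\zeta_0}$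 for all $n\ge0$ and $|\xi_0|=|\zeta_0|=1$. For real $L\ge1$ let $$\|\xi\|_L^2=\sum_{n=0}^{\lfloor L\rfloor}|\xi_n|^2+(L-\lfloor L\rfloor)\,|\xi_{\lfloor L\rfloor+1}|^2 .$$ Let $x_{-1}(z)$, $x_0(z)$, $x_1(z)$ be the half-traces of the transfer matrices over the coefficient strings $(\sin\theta_b,0)$, $(\sin\theta_a,0)$, $(\sin\theta_a,0,\sin\theta_b,0)$, divided by $z$, $z$, $z^2$ respectively so as to have determinant one; explicitly, for $z\in\partial\mathbb D$, $$x_{-1}=\operatorname{Re}(z)\sec\theta_b,\qquad x_0=\operatorname{Re}(z)\sec\theta_a,\qquad x_1=\operatorname{Re}(z^2)\sec\theta_a\sec\theta_b+\tan\theta_a\tan\theta_b .$$ Put $$I(z)=x_1^2+x_0^2+x_{-1}^2-2x_1x_0x_{-1}-1,\qquad C(z)=\max\{2+\sqrt{8+I(z)},\ \rho^{-1},\ \sigma^{-1}\},\quad \rho=\sec\theta_a,\ \sigma=\sec\theta_b,$$ $$\gamma_1(z)=\frac{\log\left(1+\frac1{4C(z)^2}\right)}{16\log\phi},\qquad \phi=\frac{1+\sqrt5}{2}.$$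 Then for every $z\in\Sigma$ there is a constant $C_1(z)>0$ such that for every $\omega\in\Omega$, every normalized solution $(\xi,\zeta)$ at $z$ for $\omega$, and every real $L\ge1$, $$\|\xi\|_L\ \ge\ C_1(z)\,L^{\gamma_1(z)} .$$ -/

import Mathlib

namespace FibWalk

open scoped ENNReal

/-! ## The Fibonacci subshift -/

/-- The alphabet `{a, b}`. -/
inductive Letter where
  | a : Letter
  | b : Letter

/-- The Fibonacci substitution `a ↦ ab`, `b ↦ a`, on letters. -/
def substLetter : Letter → List Letter
  | Letter.a => [Letter.a, Letter.b]
  | Letter.b => [Letter.a]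

/-- The Fibonacci substitution, extended to finite words by concatenation. -/
def subst (w : List Letter) : List Letter := w.flatMap substLetter

/-- The words `s_k = S^k(a)`: `a`, `ab`, `aba`, `abaab`, ... -/
def fibBlock (k : ℕ) : List Letter := subst^[k] [Letter.a]

/-- The fixed point `u = abaababaabaab...` of the substitution, the limit of the words `s_k`.
The words `s_k` are prefixes of one another and `s_n` has more than `n` letters, so
the letter of `u` at position `n` is the one of `s_n` (the default value is never used). -/
def fibWord (n : ℕ) : Letter := (fibBlock n).getD n Letter.a

/-- The Fibonacci subshift `Ω`: two-sided sequences all of whose finite subwords occur in `u`. -/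
def subshift : Set (ℤ → Letter) :=
  {ω | ∀ (m : ℤ) (l : ℕ), ∃ k : ℕ, ∀ i : ℕ, i < l → ω (m + i) = fibWord (k + i)}

/-! ## Extended CMV matrices -/

/-- `ρ = (1 - |α|²)^{1/2}`. -/
noncomputable def rho (α : ℂ) : ℝ := Real.sqrt (1 - ‖α‖ ^ 2)

/-- The Hilbert space `ℓ²(ℤ)`. -/
abbrev HZ : Type := lp (fun _ : ℤ => ℂ) 2

theorem memlp_two_of_le_shift (c : ℤ → ℂ) (K : ℝ) (hc : ∀ n, ‖c n‖ ≤ K) (k : ℤ) (f : HZ) :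
    Memℓp (fun n : ℤ => c n * f (n + k)) 2 := by
  have h2 : (0 : ℝ) < (2 : ℝ≥0∞).toReal := by norm_num
  have hf := (memℓp_gen_iff h2).1 (lp.memℓp f)
  apply memℓp_gen
  have hs := ((Equiv.addRight k).summable_iff.2 hf).mul_left (K ^ (2 : ℝ≥0∞).toReal)
  refine Summable.of_nonneg_of_le (fun n => by positivity) (fun n => ?_) hs
  have hK : 0 ≤ K := (norm_nonneg _).trans (hc n)
  rw [norm_mul, Real.mul_rpow (norm_nonneg _) (norm_nonneg _)]
  simp only [Function.comp, Equiv.coe_addRight]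
  gcongr
  exact hc n

/-- For a bounded sequence `c`, the bounded operator `(A f)(n) = c n * f (n + k)` on `ℓ²(ℤ)`:
the matrix whose only nonzero entries are `A_{n, n+k} = c n`. -/
noncomputable def diagShift (c : ℤ → ℂ) (K : ℝ) (hc : ∀ n, ‖c n‖ ≤ K) (k : ℤ) : HZ →L[ℂ] HZ :=
  LinearMap.mkContinuous
    { toFun := fun f => ⟨fun n : ℤ => c n * f (n + k), memlp_two_of_le_shift c K hc k f⟩
      map_add' := fun f g => by
        ext n
        exact mul_add (c n) (f (n + k)) (g (n + k))
      map_smul' := fun r f => by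
        ext n
        simp [mul_left_comm] } K (by
    intro f
    have h2 : (0 : ℝ) < (2 : ℝ≥0∞).toReal := by norm_num
    have hK : 0 ≤ K := (norm_nonneg _).trans (hc 0)
    refine lp.norm_le_of_tsum_le h2 (by positivity) ?_
    rw [Real.mul_rpow hK (norm_nonneg _), lp.norm_rpow_eq_tsum h2, ← tsum_mul_left,
      ← (Equiv.addRight k).tsum_eq (fun i => K ^ (2 : ℝ≥0∞).toReal * ‖f i‖ ^ (2 : ℝ≥0∞).toReal)]
    have hf := (memℓp_gen_iff h2).1 (lp.memℓp f)
    have hs := ((Equiv.addRight k).summable_iff.2 hf).mul_left (K ^ (2 : ℝ≥0∞).toReal)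
    refine Summable.tsum_le_tsum (fun n => ?_)
      ((memℓp_gen_iff h2).1 (memlp_two_of_le_shift c K hc k f)) hs
    simp only [LinearMap.coe_mk, AddHom.coe_mk, Equiv.coe_addRight]
    rw [norm_mul, Real.mul_rpow (norm_nonneg _) (norm_nonneg _)]
    gcongr
    exact hc n)

theorem diagShift_apply (c : ℤ → ℂ) (K : ℝ) (hc : ∀ n, ‖c n‖ ≤ K) (k : ℤ) (f : HZ) (n : ℤ) :
    diagShift c K hc k f n = c n * f (n + k) := rfl

/-- The entry in row `n` and column `n + k` of the extended CMV matrix with Verblunsky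
coefficients `α`. Rows `0` and `1` of the matrix are, in the columns `-1, 0, 1, 2`,
`(ᾱ₀ρ₋₁, -ᾱ₀α₋₁, ᾱ₁ρ₀, ρ₁ρ₀)` and `(ρ₀ρ₋₁, -ρ₀α₋₁, -ᾱ₁α₀, -ρ₁α₀)`. -/
noncomputable def cmvEntry (α : ℤ → ℂ) (k : ℤ) (n : ℤ) : ℂ :=
  if Even n then
    if k = -1 then star (α n) * rho (α (n - 1))
    else if k = 0 then -(star (α n) * α (n - 1))
    else if k = 1 then star (α (n + 1)) * rho (α n)
    else if k = 2 then rho (α (n + 1)) * rho (α n)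
    else 0
  else
    if k = -2 then rho (α (n - 1)) * rho (α (n - 2))
    else if k = -1 then -(rho (α (n - 1)) * α (n - 2))
    else if k = 0 then -(star (α n) * α (n - 1))
    else if k = 1 then -(rho (α n) * α (n - 1))
    else 0

theorem norm_rho_le (α : ℂ) : ‖((rho α : ℝ) : ℂ)‖ ≤ 1 := by
  rw [Complex.norm_real, Real.norm_of_nonneg (by unfold rho; exact Real.sqrt_nonneg _)]
  exact Real.sqrt_le_one.2 (by nlinarith [norm_nonneg α])

theorem norm_cmvEntry_le (α : ℤ → ℂ) (hα : ∀ n, ‖α n‖ ≤ 1) (k n : ℤ) :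
    ‖cmvEntry α k n‖ ≤ 1 := by
  have key : ∀ x y : ℂ, ‖x‖ ≤ 1 → ‖y‖ ≤ 1 → ‖x * y‖ ≤ 1 := fun x y hx hy => by
    rw [norm_mul]; exact mul_le_one₀ hx (norm_nonneg _) hy
  have hs : ∀ m, ‖star (α m)‖ ≤ 1 := fun m => by rw [norm_star]; exact hα m
  unfold cmvEntry
  split_ifs <;> (try rw [norm_neg]) <;>
    first
    | (apply key <;> first | exact hα _ | exact hs _ | exact norm_rho_le _)
    | simp

/-- The extended CMV matrix, as a bounded operator on `ℓ²(ℤ)`. -/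
noncomputable def extendedCMV (α : ℤ → ℂ) (hα : ∀ n, ‖α n‖ ≤ 1) : HZ →L[ℂ] HZ :=
  ∑ k ∈ Finset.Icc (-2 : ℤ) 2,
    diagShift (cmvEntry α k) 1 (norm_cmvEntry_le α hα k) k

/-! ## The Fibonacci quantum walk -/

/-- The angle `θ_a` or `θ_b` belonging to a letter. -/
def angle (θa θb : ℝ) : Letter → ℝ
  | Letter.a => θa
  | Letter.b => θb

/-- The Verblunsky coefficients `α_{2n} = sin θ_{ω_n}`, `α_{2n+1} = 0`. -/
noncomputable def verblunsky (θa θb : ℝ) (ω : ℤ → Letter) (m : ℤ) : ℂ :=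
  if Even m then ((Real.sin (angle θa θb (ω (m / 2))) : ℝ) : ℂ) else 0

theorem norm_verblunsky_le (θa θb : ℝ) (ω : ℤ → Letter) (m : ℤ) :
    ‖verblunsky θa θb ω m‖ ≤ 1 := by
  unfold verblunsky
  split_ifs
  · rw [Complex.norm_real, Real.norm_eq_abs]; exact Real.abs_sin_le_one _
  · simp

/-- The operator `U_ω = E_ω` of the quantum walk with coins given by `ω`. -/
noncomputable def walkOp (θa θb : ℝ) (ω : ℤ → Letter) : HZ →L[ℂ] HZ :=
  extendedCMV (verblunsky θa θb ω) (norm_verblunsky_le θa θb ω)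

/-- The set `Σ`. The spectrum of `E_ω` is the same for all `ω` in the subshift; here `Σ` is taken
to be the union of these spectra, so that no choice of `ω` is involved. -/
noncomputable def spec (θa θb : ℝ) : Set ℂ :=
  {z | ∃ ω ∈ subshift, z ∈ spectrum ℂ (walkOp θa θb ω)}

/-! ## Transfer matrices -/

/-- The one-step transfer matrix `T(z, α)`. -/
noncomputable def transfer (z α : ℂ) : Matrix (Fin 2) (Fin 2) ℂ :=
  ((rho α : ℝ) : ℂ)⁻¹ • !![z, -star α; -(α * z), 1]

/-- `T(z, α₁ … α_l) = T(z, α_l) ⋯ T(z, α₁)`. -/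
noncomputable def transferWord (z : ℂ) : List ℂ → Matrix (Fin 2) (Fin 2) ℂ
  | [] => 1
  | α :: w => transferWord z w * transfer z α

/-- `T_n(z; ω) = T(z, α_{ω,0} … α_{ω,n-1})`. -/
noncomputable def transferN (θa θb : ℝ) (ω : ℤ → Letter) (z : ℂ) (n : ℕ) :
    Matrix (Fin 2) (Fin 2) ℂ :=
  transferWord z ((List.range n).map fun j => verblunsky θa θb ω (j : ℤ))

/-- The sequence `(ξ_n, ζ_n) = T_n(z; ω) (ξ_0, ζ_0)` with `|ξ_0| = |ζ_0| = 1`. -/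
def IsNormalizedSolution (θa θb : ℝ) (ω : ℤ → Letter) (z : ℂ) (ξ ζ : ℕ → ℂ) : Prop :=
  (∀ n : ℕ, ![ξ n, ζ n] = (transferN θa θb ω z n).mulVec ![ξ 0, ζ 0]) ∧ ‖ξ 0‖ = 1 ∧ ‖ζ 0‖ = 1

/-- `‖ξ‖_L`, where `‖ξ‖_L² = ∑_{n=0}^{⌊L⌋} |ξ_n|² + (L - ⌊L⌋) |ξ_{⌊L⌋+1}|²`. -/
noncomputable def localNorm (ξ : ℕ → ℂ) (L : ℝ) : ℝ :=
  Real.sqrt (∑ n ∈ Finset.range (⌊L⌋₊ + 1), ‖ξ n‖ ^ 2 + (L - ⌊L⌋₊) * ‖ξ (⌊L⌋₊ + 1)‖ ^ 2)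

/-! ## Traces, invariant and exponent -/

/-- The string of Verblunsky coefficients belonging to a word: `sin θ_c, 0` for each letter `c`. -/
noncomputable def codeWord (θa θb : ℝ) (w : List Letter) : List ℂ :=
  w.flatMap fun c => [((Real.sin (angle θa θb c) : ℝ) : ℂ), 0]

/-- Half the trace of the transfer matrix over a word `w`. Its determinant is `z ^ (2 |w|)`, and it
is divided by `z ^ |w|` to be unimodular; the half-trace is then real for `|z| = 1`. -/
noncomputable def halfTrace (θa θb : ℝ) (z : ℂ) (w : List Letter) : ℝ :=
  ((transferWord z (codeWord θa θb w)).trace / (2 * z ^ w.length)).re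

/-- The half-trace `x_{-1}`; the half-traces `x_{-1}`, `x_0`, `x_1` belong to `b`, `a`, `ab`. -/
noncomputable def xNegOne (θa θb : ℝ) (z : ℂ) : ℝ := halfTrace θa θb z [Letter.b]

/-- The half-trace `x_0`. -/
noncomputable def xZero (θa θb : ℝ) (z : ℂ) : ℝ := halfTrace θa θb z (fibBlock 0)

/-- The half-trace `x_1`. -/
noncomputable def xOne (θa θb : ℝ) (z : ℂ) : ℝ := halfTrace θa θb z (fibBlock 1)

theorem rho_sin (θ : ℝ) (h : 0 < Real.cos θ) :
    rho ((Real.sin θ : ℝ) : ℂ) = Real.cos θ := by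
  rw [rho, Complex.norm_real, Real.norm_eq_abs, sq_abs, ← Real.cos_sq', Real.sqrt_sq h.le]

theorem rho_zero : rho 0 = 1 := by simp [rho]

theorem halfTrace_singleton (θa θb : ℝ) (z : ℂ) (hz : ‖z‖ = 1) (c : Letter)
    (h : 0 < Real.cos (angle θa θb c)) :
    halfTrace θa θb z [c] = z.re / Real.cos (angle θa θb c) := by
  have hz0 : z ≠ 0 := by rintro rfl; simp at hz
  have hc : ((Real.cos (angle θa θb c) : ℝ) : ℂ) ≠ 0 := by exact_mod_cast h.ne'
  have hinv : z⁻¹ = star z := Complex.inv_eq_conj hz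
  have key : (transferWord z (codeWord θa θb [c])).trace / (2 * z ^ [c].length)
      = (z + z⁻¹) / 2 / ((Real.cos (angle θa θb c) : ℝ) : ℂ) := by
    simp only [codeWord, List.flatMap_cons, List.flatMap_nil, List.append_nil, transferWord,
      transfer, rho_sin _ h, rho_zero, Matrix.one_mul, Matrix.trace_fin_two, List.length_singleton]
    simp [Matrix.mul_apply, Fin.sum_univ_two]
    field_simp
  rw [halfTrace, key, hinv, Complex.star_def, Complex.add_conj, Complex.div_ofReal_re]
  simp

/-- The explicit form of the half-traces on the unit circle. -/
theorem xNegOne_eq (θa θb : ℝ) (z : ℂ) (hz : ‖z‖ = 1) (hb : 0 < Real.cos θb) :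
    xNegOne θa θb z = z.re / Real.cos θb :=
  halfTrace_singleton θa θb z hz Letter.b hb

theorem xZero_eq (θa θb : ℝ) (z : ℂ) (hz : ‖z‖ = 1) (ha : 0 < Real.cos θa) :
    xZero θa θb z = z.re / Real.cos θa :=
  halfTrace_singleton θa θb z hz Letter.a ha

theorem xOne_eq (θa θb : ℝ) (z : ℂ) (hz : ‖z‖ = 1) (ha : 0 < Real.cos θa)
    (hb : 0 < Real.cos θb) :
    xOne θa θb z
      = (z ^ 2).re / (Real.cos θa * Real.cos θb) + Real.tan θa * Real.tan θb := by
  have hz0 : z ≠ 0 := by rintro rfl; simp at hz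
  have hca : ((Real.cos θa : ℝ) : ℂ) ≠ 0 := by exact_mod_cast ha.ne'
  have hcb : ((Real.cos θb : ℝ) : ℂ) ≠ 0 := by exact_mod_cast hb.ne'
  have hinv : (z ^ 2)⁻¹ = star (z ^ 2) := Complex.inv_eq_conj (by simp [hz])
  have key : (transferWord z (codeWord θa θb (fibBlock 1))).trace / (2 * z ^ (fibBlock 1).length)
      = ((z ^ 2 + (z ^ 2)⁻¹) / 2 + ((Real.sin θa * Real.sin θb : ℝ) : ℂ))
        / ((Real.cos θa * Real.cos θb : ℝ) : ℂ) := by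
    simp only [fibBlock, Function.iterate_one, subst, substLetter, codeWord, List.flatMap_cons,
      List.flatMap_nil, List.append_nil, transferWord, List.cons_append, List.nil_append, angle,
      transfer, rho_sin _ ha, rho_sin _ hb, rho_zero, Matrix.one_mul, Matrix.trace_fin_two,
      List.length_cons, List.length_nil]
    simp [Matrix.mul_apply, Fin.sum_univ_two, -Complex.ofReal_sin, -Complex.ofReal_cos]
    field_simp
    ring
  rw [xOne, halfTrace, key, hinv, Complex.star_def, Complex.add_conj, Complex.div_ofReal_re,
    Real.tan_eq_sin_div_cos, Real.tan_eq_sin_div_cos, Complex.add_re, Complex.ofReal_re]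
  simp only [Complex.ofReal_mul, mul_div_assoc]
  simp [-Complex.ofReal_sin]
  field_simp

/-- The Fricke-Vogt invariant `I(z)`. -/
noncomputable def invariant (θa θb : ℝ) (z : ℂ) : ℝ :=
  xOne θa θb z ^ 2 + xZero θa θb z ^ 2 + xNegOne θa θb z ^ 2
    - 2 * xOne θa θb z * xZero θa θb z * xNegOne θa θb z - 1

/-- `C(z) = max {2 + (8 + I(z))^{1/2}, ρ⁻¹, σ⁻¹}` with `ρ = sec θ_a`, `σ = sec θ_b`. -/
noncomputable def traceBound (θa θb : ℝ) (z : ℂ) : ℝ :=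
  max (2 + Real.sqrt (8 + invariant θa θb z))
    (max ((Real.cos θa)⁻¹)⁻¹ ((Real.cos θb)⁻¹)⁻¹)

/-- `γ₁(z) = log (1 + 1 / (4 C(z)²)) / (16 log φ)`. -/
noncomputable def gammaOne (θa θb : ℝ) (z : ℂ) : ℝ :=
  Real.log (1 + 1 / (4 * traceBound θa θb z ^ 2)) / (16 * Real.log Real.goldenRatio)

end FibWalk

/-!
The lower bound comes from the squares which every element of the Fibonacci subshift shows at every
scale. Divided by `z`, the transfer matrices over the letters are unimodular, so if `w w` occurs in
`ω` and `M` is the matrix over `w`, the theorem of Cayley and Hamilton `M² = (tr M) M - 1` bounds a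
component of a solution in front of the square by its values one and two periods later, with a
constant depending only on `tr M` (`IsNormalizedSolution.sq_le_of_square`).

Two facts are needed. The first is combinatorial (`exists_square_window`): from every position of
the Fibonacci word starts a stretch with period `F`, one of four consecutive Fibonacci numbers, which
is longer than `2 F` by a definite proportion. All values of a solution on an initial interval are
then controlled through the same period `F`, and the mass of the solution is multiplied by at least
`1 + 1 / (4 C²)` each time the length is multiplied by `φ⁸`; this is the exponent `γ₁`.

The second is that for `z` in the spectrum the half-traces of the words `S^n(b)` are eventually
bounded by `C - 1/2`. They form an orbit of the trace map `y₃ = 2 y₂ y₁ - y₀`. An orbit which never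
satisfies the escape condition `|y₁|, |y₂| > 1`, `|y₁ y₂| > |y₀|` is eventually bounded in terms of
the invariant (`eventually_abs_le`). If the condition held at a point of the spectrum
(`not_escapes_of_mem_spec`), then it would hold on a neighbourhood in the circle and would give
`|y_i| > 1` there for all large `i`. But `|y_i(w)| > 1` excludes `w` from the spectrum of the walk
which repeats the word `S^i(b)` periodically (`exists_le_norm_walkOp_sub`). These walks are unitary,
so the distance from `z` to their spectra is a lower bound for `‖(U - z) f‖`, uniformly in `i`; as
every finite window of `ω` is a window of such a periodic sequence, the bound passes to `ω`, and `z`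
is not in the spectrum.
-/

namespace FibWalk

/-! ### The Fibonacci word and its repetitions -/

/-- The words `S^n(b)`: `b`, `a`, `ab`, `aba`, ... -/
def block (n : ℕ) : List Letter := subst^[n] [Letter.b]

theorem subst_append (v w : List Letter) : subst (v ++ w) = subst v ++ subst w := by
  simp [subst]

theorem subst_iterate_append (n : ℕ) (v w : List Letter) :
    subst^[n] (v ++ w) = subst^[n] v ++ subst^[n] w := by
  induction n generalizing v w with
  | zero => rfl
  | succ n ih => simp only [Function.iterate_succ_apply, subst_append, ih]

theorem subst_iterate_nil (n : ℕ) : subst^[n] [] = [] := by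
  induction n with
  | zero => rfl
  | succ n ih => rw [Function.iterate_succ_apply]; exact ih

theorem subst_iterate_a (n : ℕ) : subst^[n] [Letter.a] = block (n + 1) := by
  rw [block, Function.iterate_succ_apply]; rfl

theorem fibBlock_eq (n : ℕ) : fibBlock n = block (n + 1) := subst_iterate_a n

theorem block_succ_succ (n : ℕ) : block (n + 2) = block (n + 1) ++ block n := by
  rw [← subst_iterate_a, Function.iterate_succ_apply]
  exact subst_iterate_append n [Letter.a] [Letter.b] |>.trans (by rw [subst_iterate_a]; rfl)

theorem length_block (n : ℕ) : (block n).length = Nat.fib (n + 1) := by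
  induction n using Nat.twoStepInduction with
  | zero => rfl
  | one => rfl
  | more n h1 h2 => rw [block_succ_succ, List.length_append, h1, h2, Nat.fib_add_two (n := n + 1)]; ring

theorem block_prefix {m n : ℕ} (h : m ≤ n) : block (m + 1) <+: block (n + 1) := by
  induction n, h using Nat.le_induction with
  | base => exact List.prefix_rfl
  | succ n _ ih => exact ih.trans (by rw [block_succ_succ n]; exact List.prefix_append _ _)

theorem lt_fib_add_two (i : ℕ) : i < Nat.fib (i + 2) := by
  induction i with
  | zero => simp
  | succ i ih =>
    have h1 : Nat.fib (i + 3) = Nat.fib (i + 1) + Nat.fib (i + 2) := Nat.fib_add_two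
    have h2 : 0 < Nat.fib (i + 1) := Nat.fib_pos.2 (by omega)
    show i + 1 < Nat.fib (i + 3)
    omega

theorem block_getElem? (n i : ℕ) (h : i < (block (n + 1)).length) :
    (block (n + 1))[i]? = some (fibWord i) := by
  have hi : i < (block (i + 1)).length := by
    rw [length_block]; exact lt_fib_add_two i
  have key : (block (i + 1))[i]? = some (fibWord i) := by
    rw [fibWord, fibBlock_eq, List.getD_eq_getElem?_getD, List.getElem?_eq_getElem hi]; rfl
  rcases le_total i n with hin | hin
  · rw [← key, List.getElem?_eq_getElem h, List.getElem?_eq_getElem hi,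
      (block_prefix hin).getElem hi]
  · rw [← key, List.getElem?_eq_getElem h, List.getElem?_eq_getElem hi,
      (block_prefix hin).getElem h]

/-- Adjacent blocks commute up to their last two letters. -/
theorem exists_common_prefix (n : ℕ) : ∃ (p : List Letter) (x y : Letter),
    block (n + 1) ++ block n = p ++ [x, y] ∧ block n ++ block (n + 1) = p ++ [y, x] := by
  induction n with
  | zero => exact ⟨[], Letter.a, Letter.b, rfl, rfl⟩
  | succ n ih =>
    obtain ⟨p, x, y, h1, h2⟩ := ih
    refine ⟨block (n + 1) ++ p, y, x, ?_, ?_⟩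
    · rw [block_succ_succ, List.append_assoc, h2, List.append_assoc]
    · rw [block_succ_succ, h1, List.append_assoc]

theorem suffix_subst {v w : List Letter} (h : v <:+ subst w) :
    ∃ w', w' <:+ w ∧ (v = subst w' ∨ v = Letter.b :: subst w') := by
  induction w with
  | nil => exact ⟨[], List.suffix_rfl, Or.inl (List.suffix_nil.1 h)⟩
  | cons c w ih =>
    have step : v <:+ subst w → ∃ w', w' <:+ c :: w ∧ (v = subst w' ∨ v = Letter.b :: subst w') :=
      fun h => let ⟨w', h1, h2⟩ := ih h; ⟨w', h1.trans (List.suffix_cons _ _), h2⟩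
    cases c with
    | a =>
      rcases List.suffix_cons_iff.1 (show v <:+ Letter.a :: Letter.b :: subst w from h) with h | h
      · exact ⟨_, List.suffix_rfl, Or.inl h⟩
      rcases List.suffix_cons_iff.1 h with h | h
      · exact ⟨w, List.suffix_cons _ _, Or.inr h⟩
      · exact step h
    | b =>
      rcases List.suffix_cons_iff.1 (show v <:+ Letter.a :: subst w from h) with h | h
      · exact ⟨_, List.suffix_rfl, Or.inl h⟩
      · exact step h

theorem subst_ne_b_cons (w v : List Letter) : subst w ≠ Letter.b :: v := by
  rcases w with _ | ⟨c, w⟩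
  · simp [subst]
  · cases c <;> simp [subst, substLetter]

theorem not_bb_suffix (v w : List Letter) : ¬ Letter.b :: Letter.b :: v <:+ subst w := by
  intro h
  obtain ⟨w', -, h | h⟩ := suffix_subst h
  · exact subst_ne_b_cons _ _ h.symm
  · exact subst_ne_b_cons _ _ (List.cons.inj h).2.symm

theorem suffix_subst_a {v w : List Letter} (h : Letter.a :: v <:+ subst w) :
    ∃ w', w' <:+ w ∧ Letter.a :: v = subst w' := by
  obtain ⟨w', h1, h2 | h2⟩ := suffix_subst h
  · exact ⟨w', h1, h2⟩
  · simp at h2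

theorem suffix_subst_ab {v w : List Letter} (h : Letter.a :: Letter.b :: v <:+ subst w) :
    ∃ w', Letter.a :: w' <:+ w ∧ Letter.a :: Letter.b :: v = subst (Letter.a :: w') := by
  obtain ⟨w', h1, h2⟩ := suffix_subst_a h
  rcases w' with _ | ⟨c, w'⟩
  · simp [subst] at h2
  · cases c with
    | a => exact ⟨w', h1, h2⟩
    | b => exact absurd (List.cons.inj h2).2.symm (subst_ne_b_cons _ _)

theorem not_aaa_suffix (v w : List Letter) :
    ¬ Letter.a :: Letter.a :: Letter.a :: v <:+ subst (subst w) := by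
  intro h
  obtain ⟨w', h1, h2⟩ := suffix_subst_a h
  rcases w' with _ | ⟨c, _ | ⟨d, w'⟩⟩
  · simp [subst] at h2
  · cases c <;> simp [subst, substLetter] at h2
  · cases c <;> cases d <;> simp [subst, substLetter] at h2
    exact not_bb_suffix _ _ h1

/-- A suffix of `S²(w)` which starts with `a` starts with `aab` or with `aba`. -/
theorem suffix_cases {v w : List Letter} (h : Letter.a :: v <:+ subst (subst w))
    (hv : 2 ≤ v.length) :
    (∃ r, v = Letter.a :: Letter.b :: r) ∨ (∃ r, v = Letter.b :: Letter.a :: r) := by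
  rcases v with _ | ⟨c, _ | ⟨d, r⟩⟩
  · simp at hv
  · simp at hv
  · cases c <;> cases d
    · exact absurd h (not_aaa_suffix _ _)
    · exact Or.inl ⟨r, rfl⟩
    · exact Or.inr ⟨r, rfl⟩
    · exact absurd ((List.suffix_cons _ _).trans h) (not_bb_suffix _ _)

theorem subst_iterate_cons (n : ℕ) (c : Letter) (v : List Letter) :
    subst^[n] (c :: v) = subst^[n] [c] ++ subst^[n] v :=
  subst_iterate_append n [c] v

/-- Whatever follows it, a block `S^J(a)` in the Fibonacci word starts a stretch of
`|S^J(a)| + |S^{J+1}(a)| - 2` letters with period `|S^J(a)|`. -/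
theorem getElem?_subst_iterate {J : ℕ} (hJ : 1 ≤ J) {v w : List Letter}
    (h : Letter.a :: v <:+ subst (subst w)) (hv : 2 ≤ v.length) (t : ℕ)
    (ht : t < 2 * (block (J + 1)).length + (block J).length - 2) :
    (subst^[J] (Letter.a :: v))[t]? = some (fibWord (t % (block (J + 1)).length)) := by
  obtain ⟨p, x, y, h1, h2⟩ := exists_common_prefix J
  have hlen : (block (J + 1)).length + (block J).length = p.length + 2 := by
    simpa using congrArg List.length h1
  have hB : ∀ i < (block J).length, (block J)[i]? = some (fibWord i) := by
    obtain ⟨J, rfl⟩ : ∃ J', J = J' + 1 := ⟨J - 1, by omega⟩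
    exact fun i hi => block_getElem? J i hi
  have hb0 : subst^[J] [Letter.b] = block J := rfl
  obtain ⟨r, hr⟩ : ∃ r, subst^[J] (Letter.a :: v) = (block (J + 1) ++ p) ++ r := by
    rcases suffix_cases h hv with ⟨r, rfl⟩ | ⟨r, rfl⟩
    · refine ⟨[x, y] ++ subst^[J] r, ?_⟩
      rw [subst_iterate_cons J _ (_ :: _), subst_iterate_cons J _ (_ :: _), subst_iterate_cons J _ r,
        subst_iterate_a, hb0, ← List.append_assoc (block (J + 1)) (block J), h1]
      simp
    · refine ⟨[y, x] ++ subst^[J] r, ?_⟩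
      rw [subst_iterate_cons J _ (_ :: _), subst_iterate_cons J _ (_ :: _), subst_iterate_cons J _ r,
        subst_iterate_a, hb0, ← List.append_assoc (block J), h2]
      simp
  rw [hr, List.getElem?_append_left (by simp; omega)]
  rcases lt_or_ge t (block (J + 1)).length with h3 | h3
  · rw [List.getElem?_append_left h3, Nat.mod_eq_of_lt h3, block_getElem? J t h3]
  rw [List.getElem?_append_right h3]
  obtain ⟨s, rfl⟩ := Nat.exists_eq_add_of_le h3
  rw [Nat.add_sub_cancel_left, Nat.add_mod_left]
  have h4 : p[s]? = (block (J + 1) ++ block J)[s]? := by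
    rw [h1, List.getElem?_append_left (by omega)]
  rw [h4]
  rcases lt_or_ge s (block (J + 1)).length with h5 | h5
  · rw [List.getElem?_append_left h5, Nat.mod_eq_of_lt h5, block_getElem? J s h5]
  · have hle : (block J).length ≤ (block (J + 1)).length := by
      rw [length_block, length_block]; exact Nat.fib_mono (by omega)
    obtain ⟨s, rfl⟩ := Nat.exists_eq_add_of_le h5
    rw [List.getElem?_append_right h5, Nat.add_sub_cancel_left, Nat.add_mod_left,
      Nat.mod_eq_of_lt (by omega), hB s (by omega)]

/-- Two consecutive blocks `S^J(a)` prolong the periodic stretch by `|S^J(a)|`. -/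
theorem getElem?_subst_iterate_aa {J : ℕ} (hJ : 1 ≤ J) {v w : List Letter}
    (h : Letter.a :: Letter.a :: v <:+ subst (subst w)) (hv : 2 ≤ v.length) (t : ℕ)
    (ht : t < 3 * (block (J + 1)).length + (block J).length - 2) :
    (subst^[J] (Letter.a :: Letter.a :: v))[t]?
      = some (fibWord (t % (block (J + 1)).length)) := by
  rw [subst_iterate_cons, subst_iterate_a]
  rcases lt_or_ge t (block (J + 1)).length with h3 | h3
  · rw [List.getElem?_append_left h3, Nat.mod_eq_of_lt h3, block_getElem? J t h3]
  · rw [List.getElem?_append_right h3, Nat.mod_eq_sub_mod h3]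
    exact getElem?_subst_iterate hJ ((List.suffix_cons _ _).trans h) hv _ (by omega)

theorem length_subst_le (w : List Letter) : (subst w).length ≤ 2 * w.length := by
  induction w with
  | nil => simp [subst]
  | cons c w ih =>
    have : subst (c :: w) = substLetter c ++ subst w := rfl
    rw [this, List.length_append, List.length_cons]
    cases c <;> simp [substLetter] <;> omega

theorem length_block_succ_succ (n : ℕ) :
    (block (n + 2)).length = (block (n + 1)).length + (block n).length := by
  rw [block_succ_succ, List.length_append]

theorem exists_square_of_suffix {J : ℕ} (hJ : 1 ≤ J) {v w : List Letter}
    (h : Letter.a :: v <:+ subst (subst (subst (subst w)))) (hv : 12 ≤ v.length) {o : ℕ}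
    (ho : o < (block (J + 1)).length) :
    ∃ j, J + 1 ≤ j ∧ j ≤ J + 3 ∧ ∀ t < o + (2 * (block j).length + (block J).length - 2),
      (subst^[J] (Letter.a :: v))[t]? = some (fibWord (t % (block j).length)) := by
  have l2 := length_block_succ_succ J
  have l3 : (block (J + 3)).length = (block (J + 2)).length + (block (J + 1)).length :=
    length_block_succ_succ (J + 1)
  rcases suffix_cases h (by omega) with ⟨r, rfl⟩ | ⟨r, rfl⟩
  · simp only [List.length_cons] at hv
    exact ⟨J + 1, by omega, by omega, fun t ht =>
      getElem?_subst_iterate_aa hJ h (by simp; omega) t (by omega)⟩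
  obtain ⟨v₁, s₁, e₁⟩ := suffix_subst_ab h
  have n₁ := length_subst_le (Letter.a :: v₁)
  rw [← e₁] at n₁
  simp only [List.length_cons] at n₁ hv
  rw [e₁, ← Function.iterate_succ_apply]
  rcases suffix_cases s₁ (by omega) with ⟨r', rfl⟩ | ⟨r', rfl⟩
  · simp only [List.length_cons] at n₁
    exact ⟨J + 2, by omega, by omega, fun t ht =>
      getElem?_subst_iterate_aa (J := J + 1) (by omega) s₁ (by simp; omega) t
        (show t < 3 * (block (J + 2)).length + (block (J + 1)).length - 2 by omega)⟩
  obtain ⟨v₂, s₂, e₂⟩ := suffix_subst_ab s₁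
  have n₂ := length_subst_le (Letter.a :: v₂)
  rw [← e₂] at n₂
  simp only [List.length_cons] at n₂ n₁
  rw [e₂, ← Function.iterate_succ_apply]
  exact ⟨J + 3, by omega, by omega, fun t ht =>
    getElem?_subst_iterate (J := J + 2) (by omega) s₂ (by omega) t
      (show t < 2 * (block (J + 3)).length + (block (J + 2)).length - 2 by omega)⟩

theorem exists_split (J : ℕ) (v : List Letter) (q : ℕ) (hq : q < (subst^[J] v).length) :
    ∃ l₁ c l₂, v = l₁ ++ c :: l₂ ∧ (subst^[J] l₁).length ≤ q ∧
      q < (subst^[J] l₁).length + (subst^[J] [c]).length := by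
  induction v generalizing q with
  | nil => simp [subst_iterate_nil] at hq
  | cons d v ih =>
    rcases lt_or_ge q (subst^[J] [d]).length with h | h
    · exact ⟨[], d, v, rfl, by simp [subst_iterate_nil], by simpa [subst_iterate_nil] using h⟩
    · rw [subst_iterate_cons, List.length_append] at hq
      obtain ⟨l₁, c, l₂, h1, h2, h3⟩ := ih (q - (subst^[J] [d]).length) (by omega)
      refine ⟨d :: l₁, c, l₂, by rw [h1]; rfl, ?_, ?_⟩ <;>
        (rw [subst_iterate_cons, List.length_append]; omega)

theorem length_subst_iterate_le (J : ℕ) (v : List Letter) :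
    (subst^[J] v).length ≤ v.length * (block (J + 1)).length := by
  induction v with
  | nil => simp [subst_iterate_nil]
  | cons c v ih =>
    have hc : (subst^[J] [c]).length ≤ (block (J + 1)).length := by
      cases c
      · rw [subst_iterate_a]
      · rw [length_block]
        exact (length_block J).le.trans (Nat.fib_mono (by omega))
    rw [subst_iterate_cons, List.length_append, List.length_cons, Nat.add_mul, one_mul]
    omega

/-- From every position of the Fibonacci word, and at every scale, one sees a stretch with one of
four consecutive Fibonacci periods which is longer than twice the period by a definite
proportion. -/
theorem exists_square_window {K : ℕ} (hK : 1 ≤ K) (q : ℕ) :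
    ∃ j, K + 1 ≤ j ∧ j ≤ K + 4 ∧ ∃ c, ∀ t < 2 * (block j).length + (block K).length - 2,
      fibWord (q + t) = fibWord ((c + t) % (block j).length) := by
  set B := (block (K + 2)).length with hB
  -- a prefix of the Fibonacci word reaching far beyond the position `q`
  obtain ⟨M, hM⟩ : ∃ M, q + 13 * B < (block (K + 1 + (M + 4) + 1)).length := by
    refine ⟨q + 13 * B, ?_⟩
    rw [length_block]
    have := Nat.le_fib_add_one (K + 1 + (q + 13 * B + 4) + 1 + 1)
    omega
  have hu : block (K + 1 + (M + 4) + 1) = subst^[K + 1] (subst^[M + 4] [Letter.a]) := by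
    rw [← Function.iterate_add_apply, subst_iterate_a]
  obtain ⟨l₁, c, l₂, h1, h2, h3⟩ := exists_split (K + 1) (subst^[M + 4] [Letter.a]) q
    (by rw [← hu]; omega)
  set P := (subst^[K + 1] l₁).length with hP
  have hw : block (K + 1 + (M + 4) + 1) = subst^[K + 1] l₁ ++ subst^[K + 1] (c :: l₂) := by
    rw [hu, h1, subst_iterate_append]
  have hlen : (block (K + 1 + (M + 4) + 1)).length = P + (subst^[K + 1] (c :: l₂)).length := by
    rw [hw, List.length_append]
  have hlong : 12 ≤ l₂.length := by
    have := length_subst_iterate_le (K + 1) (c :: l₂)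
    rw [← hB, List.length_cons] at this
    by_contra hc
    have : (l₂.length + 1) * B ≤ 12 * B := Nat.mul_le_mul_right _ (by omega)
    omega
  have hsuf : c :: l₂ <:+ subst (subst (subst (subst (subst^[M] [Letter.a])))) := by
    have : subst^[M + 4] [Letter.a] = subst (subst (subst (subst (subst^[M] [Letter.a])))) := by
      simp only [Function.iterate_succ_apply']
    rw [← this, h1]; exact List.suffix_append _ _
  have main : ∃ j, K + 1 ≤ j ∧ j ≤ K + 4 ∧
      ∀ t < (q - P) + (2 * (block j).length + (block K).length - 2),
      (subst^[K + 1] (c :: l₂))[t]? = some (fibWord (t % (block j).length)) := by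
    have hK1 := length_block_succ_succ K
    have hKle : (block K).length ≤ (block (K + 1)).length := by
      rw [length_block, length_block]; exact Nat.fib_mono (by omega)
    cases c with
    | a =>
      rw [subst_iterate_a] at h3
      obtain ⟨j, j1, j2, hj⟩ := exists_square_of_suffix (J := K + 1) (by omega) hsuf hlong
        (o := q - P) (by omega)
      exact ⟨j, by omega, by omega, fun t ht => hj t (by omega)⟩
    | b =>
      -- `S^{K+1}(b) = S^K(a)`: the position is seen at the previous level
      have e : subst (Letter.b :: l₂) = Letter.a :: subst l₂ := rfl
      have hs : Letter.a :: subst l₂ <:+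
          subst (subst (subst (subst (subst (subst^[M] [Letter.a]))))) := by
        obtain ⟨r, hr⟩ := hsuf
        exact ⟨subst r, by rw [← e, ← subst_append, hr]⟩
      have hl : l₂.length ≤ (subst l₂).length := by
        clear * -
        induction l₂ with
        | nil => simp
        | cons c w ih =>
          have : subst (c :: w) = substLetter c ++ subst w := rfl
          rw [this, List.length_append, List.length_cons]
          cases c <;> simp [substLetter] <;> omega
      have h3' : q < P + (block (K + 1)).length := h3
      obtain ⟨j, j1, j2, hj⟩ := exists_square_of_suffix (J := K) hK hs (by omega)
        (o := q - P) (by omega)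
      refine ⟨j, by omega, by omega, fun t ht => ?_⟩
      rw [Function.iterate_succ_apply, e]
      exact hj t ht
  obtain ⟨j, j1, j2, hj⟩ := main
  refine ⟨j, j1, j2, q - P, fun t ht => ?_⟩
  have h5 := hj (q - P + t) (by omega)
  obtain ⟨hlt, -⟩ := List.getElem?_eq_some_iff.1 h5
  have h6 := block_getElem? (K + 1 + (M + 4)) (q + t) (by omega)
  rw [hw, List.getElem?_append_right (by omega), show q + t - (subst^[K + 1] l₁).length
    = q - P + t by omega, h5] at h6
  exact (Option.some.inj h6).symm

/-! ### Unimodular transfer matrices and their traces -/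

section Traces

open ComplexConjugate

variable {θa θb : ℝ} {z : ℂ}

/-- The transfer matrix over the two coefficients `sin θ_c, 0` of a letter `c`, divided by `z`;
on the unit circle it is unimodular. Writing `conj z` for `z⁻¹` makes it continuous in `z`. -/
noncomputable def letterMatrix (θa θb : ℝ) (z : ℂ) (c : Letter) : Matrix (Fin 2) (Fin 2) ℂ :=
  ((Real.cos (angle θa θb c) : ℝ) : ℂ)⁻¹ •
    !![z, -((Real.sin (angle θa θb c) : ℝ) : ℂ); -((Real.sin (angle θa θb c) : ℝ) : ℂ), conj z]

/-- The product of the matrices of the letters of a word, the first letter acting first. -/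
noncomputable def wordMatrix (θa θb : ℝ) (z : ℂ) : List Letter → Matrix (Fin 2) (Fin 2) ℂ
  | [] => 1
  | c :: w => wordMatrix θa θb z w * letterMatrix θa θb z c

theorem wordMatrix_append (v w : List Letter) :
    wordMatrix θa θb z (v ++ w) = wordMatrix θa θb z w * wordMatrix θa θb z v := by
  induction v with
  | nil => simp [wordMatrix]
  | cons c v ih => rw [List.cons_append, wordMatrix, ih, wordMatrix, Matrix.mul_assoc]

theorem wordMatrix_concat (v : List Letter) (c : Letter) :
    wordMatrix θa θb z (v ++ [c]) = letterMatrix θa θb z c * wordMatrix θa θb z v := by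
  rw [wordMatrix_append]; simp [wordMatrix]

theorem transfer_zero_mul_transfer (hz : ‖z‖ = 1) {c : Letter}
    (hc : 0 < Real.cos (angle θa θb c)) :
    transfer z 0 * transfer z ((Real.sin (angle θa θb c) : ℝ) : ℂ)
      = z • letterMatrix θa θb z c := by
  have h1 : z * conj z = 1 := by rw [Complex.mul_conj', hz]; simp
  rw [letterMatrix, transfer, transfer, rho_zero, rho_sin _ hc]
  ext i j
  fin_cases i <;> fin_cases j <;>
    simp [Matrix.mul_apply, Fin.sum_univ_two, -Complex.ofReal_cos, -Complex.ofReal_sin]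
  · ring
  · linear_combination -((Real.cos (angle θa θb c) : ℝ) : ℂ)⁻¹ * h1

theorem transferWord_codeWord (hz : ‖z‖ = 1) (hc : ∀ c, 0 < Real.cos (angle θa θb c))
    (w : List Letter) :
    transferWord z (codeWord θa θb w) = z ^ w.length • wordMatrix θa θb z w := by
  induction w with
  | nil => simp [codeWord, transferWord, wordMatrix]
  | cons c w ih =>
    have : codeWord θa θb (c :: w)
        = ((Real.sin (angle θa θb c) : ℝ) : ℂ) :: 0 :: codeWord θa θb w := rfl
    rw [this, transferWord, transferWord, Matrix.mul_assoc, transfer_zero_mul_transfer hz (hc c),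
      ih, wordMatrix, List.length_cons, Matrix.smul_mul, Matrix.mul_smul, smul_smul, pow_succ]

theorem det_letterMatrix (hz : ‖z‖ = 1) {c : Letter} (hc : 0 < Real.cos (angle θa θb c)) :
    (letterMatrix θa θb z c).det = 1 := by
  have h1 : z * conj z = 1 := by rw [Complex.mul_conj', hz]; simp
  have h2 : ((Real.cos (angle θa θb c) : ℝ) : ℂ) ≠ 0 := by exact_mod_cast hc.ne'
  have h3 : ((Real.sin (angle θa θb c) : ℝ) : ℂ) ^ 2 + ((Real.cos (angle θa θb c) : ℝ) : ℂ) ^ 2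
      = 1 := by exact_mod_cast Real.sin_sq_add_cos_sq _
  rw [letterMatrix, Matrix.det_smul, Matrix.det_fin_two_of, h1, Fintype.card_fin, inv_pow,
    inv_mul_eq_one₀ (pow_ne_zero 2 h2)]
  linear_combination h3

theorem det_wordMatrix (hz : ‖z‖ = 1) (hc : ∀ c, 0 < Real.cos (angle θa θb c))
    (w : List Letter) : (wordMatrix θa θb z w).det = 1 := by
  induction w with
  | nil => simp [wordMatrix]
  | cons c w ih => rw [wordMatrix, Matrix.det_mul, ih, det_letterMatrix hz (hc c), one_mul]

/-- The entries of the matrices satisfy the reality condition of `SU(1,1)`. -/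
theorem wordMatrix_conj (w : List Letter) :
    wordMatrix θa θb z w 1 1 = conj (wordMatrix θa θb z w 0 0) ∧
      wordMatrix θa θb z w 1 0 = conj (wordMatrix θa θb z w 0 1) := by
  induction w with
  | nil => simp [wordMatrix]
  | cons c w ih =>
    simp only [wordMatrix, Matrix.mul_apply, Fin.sum_univ_two, ih.1, ih.2]
    simp only [letterMatrix, Matrix.smul_apply, Matrix.of_apply, Matrix.cons_val', smul_eq_mul,
      Matrix.cons_val_zero, Matrix.cons_val_one, Matrix.cons_val_fin_one,
      map_add, map_mul, map_neg, map_inv₀, Complex.conj_ofReal, Complex.conj_conj]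
    constructor <;> ring

theorem halfTrace_eq (hz : ‖z‖ = 1) (hc : ∀ c, 0 < Real.cos (angle θa θb c)) (w : List Letter) :
    halfTrace θa θb z w = (wordMatrix θa θb z w 0 0).re := by
  have h0 : z ≠ 0 := by rintro rfl; simp at hz
  rw [halfTrace, transferWord_codeWord hz hc, Matrix.trace_smul, smul_eq_mul, mul_comm 2,
    mul_div_mul_left _ _ (pow_ne_zero _ h0), Matrix.trace_fin_two, (wordMatrix_conj w).1,
    Complex.add_conj]
  simp

theorem trace_wordMatrix (hz : ‖z‖ = 1) (hc : ∀ c, 0 < Real.cos (angle θa θb c))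
    (w : List Letter) :
    (wordMatrix θa θb z w).trace = 2 * (halfTrace θa θb z w : ℂ) := by
  rw [halfTrace_eq hz hc, Matrix.trace_fin_two, (wordMatrix_conj w).1, Complex.add_conj]
  push_cast; ring

theorem mul_self_of_det_eq_one {M : Matrix (Fin 2) (Fin 2) ℂ} (h : M.det = 1) :
    M * M = M.trace • M - 1 := by
  rw [Matrix.det_fin_two] at h
  ext i j
  fin_cases i <;> fin_cases j <;>
    simp [Matrix.mul_apply, Fin.sum_univ_two, Matrix.trace_fin_two] <;>
    first | ring1 | linear_combination -h

theorem wordMatrix_block (n : ℕ) : wordMatrix θa θb z (block (n + 2))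
    = wordMatrix θa θb z (block n) * wordMatrix θa θb z (block (n + 1)) := by
  rw [block_succ_succ, wordMatrix_append]

/-- The trace map. -/
theorem halfTrace_block (hz : ‖z‖ = 1) (hc : ∀ c, 0 < Real.cos (angle θa θb c)) (n : ℕ) :
    halfTrace θa θb z (block (n + 3)) = 2 * halfTrace θa θb z (block (n + 2)) *
      halfTrace θa θb z (block (n + 1)) - halfTrace θa θb z (block n) := by
  have h := congrArg Matrix.trace (wordMatrix_block (θa := θa) (θb := θb) (z := z) (n + 1))
  rw [show n + 1 + 1 = n + 2 from rfl, wordMatrix_block n, Matrix.trace_mul_comm,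
    Matrix.mul_assoc, mul_self_of_det_eq_one (det_wordMatrix hz hc _), Matrix.mul_sub,
    Matrix.mul_smul, Matrix.mul_one, ← wordMatrix_block, Matrix.trace_sub, Matrix.trace_smul,
    smul_eq_mul] at h
  simp only [trace_wordMatrix hz hc] at h
  have h' : 2 * halfTrace θa θb z (block (n + 3)) = 2 * halfTrace θa θb z (block (n + 1)) *
      (2 * halfTrace θa θb z (block (n + 2))) - 2 * halfTrace θa θb z (block n) := by
    exact_mod_cast h
  linarith

theorem continuous_halfTrace (hc : ∀ c, 0 < Real.cos (angle θa θb c)) (w : List Letter) :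
    Continuous fun z : Metric.sphere (0 : ℂ) 1 => halfTrace θa θb (z : ℂ) w := by
  have hl : ∀ c, Continuous fun z : ℂ => letterMatrix θa θb z c := fun c => by
    refine continuous_matrix fun i j => ?_
    fin_cases i <;> fin_cases j <;> simp [letterMatrix, -Complex.ofReal_cos] <;> fun_prop
  have hw : Continuous fun z : ℂ => wordMatrix θa θb z w := by
    induction w with
    | nil => exact continuous_const
    | cons c w ih => exact ih.matrix_mul (hl c)
  simp only [halfTrace_eq (mem_sphere_zero_iff_norm.1 (Subtype.prop _)) hc]
  exact Complex.continuous_re.comp ((hw.matrix_elem 0 0).comp continuous_subtype_val)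

theorem invariant_eq (hz : ‖z‖ = 1) (hc : ∀ c, 0 < Real.cos (angle θa θb c)) (n : ℕ) :
    halfTrace θa θb z (block (n + 2)) ^ 2 + halfTrace θa θb z (block (n + 1)) ^ 2 +
      halfTrace θa θb z (block n) ^ 2 - 2 * halfTrace θa θb z (block (n + 2)) *
      halfTrace θa θb z (block (n + 1)) * halfTrace θa θb z (block n) - 1
      = invariant θa θb z := by
  induction n with
  | zero => rfl
  | succ n ih =>
    rw [← ih, show n + 1 + 2 = n + 3 from rfl, halfTrace_block hz hc]
    ring

end Traces

/-! ### Orbits of the trace map -/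

section TraceMap

/-- The condition under which an orbit of the trace map is known to leave every bounded set. -/
def Escapes (y : ℕ → ℝ) (j : ℕ) : Prop :=
  1 < |y (j + 1)| ∧ 1 < |y (j + 2)| ∧ |y j| < |y (j + 1) * y (j + 2)|

variable {y : ℕ → ℝ}

theorem Escapes.succ (hy : ∀ n, y (n + 3) = 2 * y (n + 2) * y (n + 1) - y n) {j : ℕ}
    (h : Escapes y j) : Escapes y (j + 1) := by
  obtain ⟨h1, h2, h3⟩ := h
  rw [abs_mul] at h3
  have h4 : |y (j + 1)| * |y (j + 2)| < |y (j + 3)| := by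
    have h5 : 2 * (|y (j + 2)| * |y (j + 1)|) - |y j| ≤ |y (j + 3)| := by
      rw [hy]
      refine le_trans (le_of_eq ?_) (abs_sub_abs_le_abs_sub _ _)
      rw [abs_mul, abs_mul, abs_two]; ring
    nlinarith
  have h6 : 1 < |y (j + 3)| := by nlinarith
  refine ⟨h2, h6, ?_⟩
  rw [show j + 1 + 1 = j + 2 from rfl, show j + 1 + 2 = j + 3 from rfl, abs_mul]
  nlinarith

theorem Escapes.one_lt (hy : ∀ n, y (n + 3) = 2 * y (n + 2) * y (n + 1) - y n) {j : ℕ}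
    (h : Escapes y j) {i : ℕ} (hi : j ≤ i) : 1 < |y (i + 1)| := by
  have : Escapes y i := by
    induction i, hi using Nat.le_induction with
    | base => exact h
    | succ i _ ih => exact ih.succ hy
  exact this.1

/-- An orbit of the trace map which does not escape is eventually bounded in terms of its
invariant. If it meets `[-1, 1]`, it can from then on never have two successive terms outside, and
a term between two terms of `[-1, 1]` is controlled by the invariant. Otherwise it decreases
to `1` in absolute value. -/
theorem eventually_abs_le {I : ℝ} (hI : ∀ n, y (n + 2) ^ 2 + y (n + 1) ^ 2 + y n ^ 2
      - 2 * y (n + 2) * y (n + 1) * y n - 1 = I) (h : ∀ j, ¬ Escapes y j) :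
    ∃ K, ∀ k, K ≤ k → |y k| ≤ 3 / 2 + √(8 + I) := by
  by_cases hex : ∃ k₀, |y k₀| ≤ 1
  · obtain ⟨k₀, hk₀⟩ := hex
    have key : ∀ k, k₀ ≤ k → |y k| ≤ 1 ∨ |y (k + 1)| ≤ 1 := by
      intro k hk
      induction k, hk using Nat.le_induction with
      | base => exact Or.inl hk₀
      | succ k _ ih =>
        by_contra! hc
        obtain ⟨c1, c2⟩ := hc
        have c0 : |y k| ≤ 1 := ih.resolve_right (not_le.2 c1)
        refine h k ⟨c1, c2, ?_⟩
        rw [abs_mul]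
        have : |y (k + 1 + 1)| = |y (k + 2)| := rfl
        nlinarith
    refine ⟨k₀ + 1, fun k hk => ?_⟩
    obtain ⟨k, rfl⟩ : ∃ k', k = k' + 1 := ⟨k - 1, by omega⟩
    have hs := Real.sqrt_nonneg (8 + I)
    rcases le_or_gt |y (k + 1)| 1 with h1 | h1
    · linarith
    have h0 := (key k (by omega)).resolve_right (not_le.2 h1)
    have h2 := (key (k + 1) (by omega)).resolve_left (not_le.2 h1)
    have h0' : y k ^ 2 ≤ 1 := (sq_le_one_iff_abs_le_one _).2 h0
    have h2' : y (k + 2) ^ 2 ≤ 1 := (sq_le_one_iff_abs_le_one _).2 h2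
    have hsq : (y (k + 1) - y (k + 2) * y k) ^ 2 = I + (1 - y (k + 2) ^ 2) * (1 - y k ^ 2) := by
      rw [← hI k]; ring
    have hle : |y (k + 1) - y (k + 2) * y k| ≤ √(8 + I) := by
      refine Real.abs_le_sqrt ?_
      rw [hsq]
      nlinarith [sq_nonneg (y k), sq_nonneg (y (k + 2))]
    have hp : |y (k + 2) * y k| ≤ 1 := by
      rw [abs_mul]; exact mul_le_one₀ h2 (abs_nonneg _) h0
    have := abs_sub_abs_le_abs_sub (y (k + 1)) (y (k + 2) * y k)
    linarith
  · push Not at hex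
    have hd : ∀ j, |y (j + 1)| * |y (j + 2)| ≤ |y j| := fun j => by
      by_contra hc
      exact h j ⟨hex _, hex _, by rw [abs_mul]; exact not_le.1 hc⟩
    have hanti : Antitone fun j => |y j| := antitone_nat_of_succ_le fun j => by
      nlinarith [hd j, hex (j + 1), hex (j + 2)]
    have hsmall : ∃ K, |y K| ≤ 3 / 2 := by
      by_contra! hc
      have hgeo : ∀ n, |y (2 * n)| ≤ (2 / 3) ^ n * |y 0| := by
        intro n
        induction n with
        | zero => simp
        | succ n ih =>
          have := hd (2 * n)
          rw [show 2 * (n + 1) = 2 * n + 2 by ring, pow_succ]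
          nlinarith [hc (2 * n + 1), hex (2 * n + 2)]
      have hy0 : 0 < |y 0| := by linarith [hex 0]
      obtain ⟨n, hn⟩ := exists_pow_lt_of_lt_one (inv_pos.2 hy0) (by norm_num : (2 / 3 : ℝ) < 1)
      have : (2 / 3) ^ n * |y 0| < 1 := by
        rw [← inv_mul_cancel₀ hy0.ne']; gcongr
      linarith [hgeo n, hex (2 * n)]
    obtain ⟨K, hK⟩ := hsmall
    exact ⟨K, fun k hk => by linarith [hanti hk, Real.sqrt_nonneg (8 + I)]⟩

end TraceMap

/-! ### The quantum walk as a unitary operator -/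

section Operator

open ComplexConjugate ContinuousLinearMap

variable {θa θb : ℝ} {ω : ℤ → Letter} {z : ℂ}

theorem extendedCMV_apply (α : ℤ → ℂ) (hα : ∀ n, ‖α n‖ ≤ 1) (f : HZ) (n : ℤ) :
    extendedCMV α hα f n = cmvEntry α (-2) n * f (n + -2) + cmvEntry α (-1) n * f (n + -1) +
      cmvEntry α 0 n * f n + cmvEntry α 1 n * f (n + 1) + cmvEntry α 2 n * f (n + 2) := by
  have h5 : Finset.Icc (-2 : ℤ) 2 = {-2, -1, 0, 1, 2} := rfl
  rw [extendedCMV, _root_.sum_apply, lp.coeFn_sum, Finset.sum_apply]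
  simp only [diagShift_apply, h5]
  simp [add_assoc]

theorem adjoint_diagShift (c : ℤ → ℂ) (K : ℝ) (hc : ∀ n, ‖c n‖ ≤ K) (k : ℤ) :
    adjoint (diagShift c K hc k) = diagShift (fun n => conj (c (n + -k))) K
      (fun n => by rw [RCLike.norm_conj]; exact hc _) (-k) := by
  symm
  rw [eq_adjoint_iff]
  intro x y
  rw [lp.inner_eq_tsum, lp.inner_eq_tsum, ← (Equiv.addRight k).tsum_eq]
  refine tsum_congr fun n => ?_
  simp [diagShift_apply]
  ring

theorem adjoint_extendedCMV_apply (α : ℤ → ℂ) (hα : ∀ n, ‖α n‖ ≤ 1) (f : HZ) (n : ℤ) :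
    adjoint (extendedCMV α hα) f n = conj (cmvEntry α (-2) (n + 2)) * f (n + 2) +
      conj (cmvEntry α (-1) (n + 1)) * f (n + 1) + conj (cmvEntry α 0 n) * f n +
      conj (cmvEntry α 1 (n + -1)) * f (n + -1) + conj (cmvEntry α 2 (n + -2)) * f (n + -2) := by
  have h5 : Finset.Icc (-2 : ℤ) 2 = {-2, -1, 0, 1, 2} := rfl
  rw [extendedCMV, map_sum]
  simp only [adjoint_diagShift]
  rw [_root_.sum_apply, lp.coeFn_sum, Finset.sum_apply]
  simp only [diagShift_apply, h5]
  simp [add_assoc]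

theorem verblunsky_even (m : ℤ) :
    verblunsky θa θb ω (2 * m) = ((Real.sin (angle θa θb (ω m)) : ℝ) : ℂ) := by
  rw [verblunsky, if_pos (even_two_mul m), Int.mul_ediv_cancel_left m two_ne_zero]

theorem verblunsky_odd (m : ℤ) : verblunsky θa θb ω (2 * m + 1) = 0 := by
  rw [verblunsky, if_neg (Int.not_even_two_mul_add_one m)]

theorem walkOp_even (hc : ∀ c, 0 < Real.cos (angle θa θb c)) (f : HZ) (m : ℤ) :
    walkOp θa θb ω f (2 * m) = ((Real.sin (angle θa θb (ω m)) : ℝ) : ℂ) * f (2 * m - 1) +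
      ((Real.cos (angle θa θb (ω m)) : ℝ) : ℂ) * f (2 * m + 2) := by
  have e1 : 2 * m - 1 = 2 * (m - 1) + 1 := by ring
  rw [walkOp, extendedCMV_apply]
  simp only [cmvEntry, even_two_mul, if_true, e1, verblunsky_even, verblunsky_odd, rho_sin _ (hc _),
    rho_zero]
  simp [-Complex.ofReal_sin, -Complex.ofReal_cos]
  left; ring_nf

theorem walkOp_odd (hc : ∀ c, 0 < Real.cos (angle θa θb c)) (f : HZ) (m : ℤ) :
    walkOp θa θb ω f (2 * m + 1) = ((Real.cos (angle θa θb (ω m)) : ℝ) : ℂ) * f (2 * m - 1) -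
      ((Real.sin (angle θa θb (ω m)) : ℝ) : ℂ) * f (2 * m + 2) := by
  have e1 : 2 * m + 1 - 2 = 2 * (m - 1) + 1 := by ring
  have e2 : 2 * m + 1 - 1 = 2 * m := by ring
  rw [walkOp, extendedCMV_apply]
  simp only [cmvEntry, Int.not_even_two_mul_add_one, if_false, e1, e2, verblunsky_even,
    verblunsky_odd, rho_sin _ (hc _), rho_zero]
  simp [-Complex.ofReal_sin, -Complex.ofReal_cos]
  rw [show 2 * m + 1 + -2 = 2 * m - 1 by ring, show 2 * m + 1 + 1 = 2 * m + 2 by ring]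
  ring

theorem adjoint_walkOp_even (hc : ∀ c, 0 < Real.cos (angle θa θb c)) (f : HZ) (m : ℤ) :
    adjoint (walkOp θa θb ω) f (2 * m + 2) =
      ((Real.cos (angle θa θb (ω m)) : ℝ) : ℂ) * f (2 * m) -
      ((Real.sin (angle θa θb (ω m)) : ℝ) : ℂ) * f (2 * m + 1) := by
  have h1 : Even (2 * m + 2 + 2) := ⟨m + 2, by ring⟩
  have h2 : ¬ Even (2 * m + 2 + 1) := by
    rw [show 2 * m + 2 + 1 = 2 * (m + 1) + 1 by ring]; exact Int.not_even_two_mul_add_one _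
  have h3 : Even (2 * m + 2) := ⟨m + 1, by ring⟩
  have h4 : ¬ Even (2 * m + 2 + -1) := by
    rw [show 2 * m + 2 + -1 = 2 * m + 1 by ring]; exact Int.not_even_two_mul_add_one _
  have h5 : Even (2 * m + 2 + -2) := ⟨m, by ring⟩
  have e1 : 2 * m + 2 + 1 - 1 = 2 * (m + 1) := by ring
  have e2 : 2 * m + 2 + 1 - 2 = 2 * m + 1 := by ring
  have e3 : 2 * m + 2 - 1 = 2 * m + 1 := by ring
  have e4 : 2 * m + 2 + -1 = 2 * m + 1 := by ring
  have e5 : 2 * m + 1 - 1 = 2 * m := by ring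
  have e6 : 2 * m + 2 + -2 = 2 * m := by ring
  rw [walkOp, adjoint_extendedCMV_apply]
  simp only [cmvEntry, h1, h2, h3, h4, h5, if_true, if_false, e1, e2, e3]
  simp only [e4, e5, e6, verblunsky_even, verblunsky_odd, rho_sin _ (hc _), rho_zero]
  simp [-Complex.ofReal_sin, -Complex.ofReal_cos, Complex.conj_ofReal]
  ring

theorem adjoint_walkOp_odd (hc : ∀ c, 0 < Real.cos (angle θa θb c)) (f : HZ) (m : ℤ) :
    adjoint (walkOp θa θb ω) f (2 * m - 1) =
      ((Real.sin (angle θa θb (ω m)) : ℝ) : ℂ) * f (2 * m) +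
      ((Real.cos (angle θa θb (ω m)) : ℝ) : ℂ) * f (2 * m + 1) := by
  have odd : ∀ k : ℤ, k = 2 * (m - 2) + 1 ∨ k = 2 * (m - 1) + 1 ∨ k = 2 * m + 1 → ¬ Even k := by
    rintro k (rfl | rfl | rfl) <;> exact Int.not_even_two_mul_add_one _
  have h1 : ¬ Even (2 * m - 1 + 2) := odd _ (by omega)
  have h3 : ¬ Even (2 * m - 1) := odd _ (by omega)
  have h4 : Even (2 * m - 1 + -1) := ⟨m - 1, by ring⟩
  have h5 : ¬ Even (2 * m - 1 + -2) := odd _ (by omega)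
  have e1 : 2 * m - 1 + 2 - 1 = 2 * m := by ring
  have e2 : 2 * m - 1 + 2 - 2 = 2 * (m - 1) + 1 := by ring
  have e3 : 2 * m - 1 + 1 = 2 * m := by ring
  have e4 : 2 * m - 1 = 2 * (m - 1) + 1 := by ring
  have e5 : 2 * (m - 1) + 1 + -1 + 1 = 2 * (m - 1) + 1 := by ring
  have e6 : 2 * (m - 1) + 1 + 2 = 2 * m + 1 := by ring
  rw [walkOp, adjoint_extendedCMV_apply]
  simp only [cmvEntry, h1, h3, h4, h5, if_true, if_false, e1, e2, e3]
  simp only [e4, e5, e6, verblunsky_even, verblunsky_odd, rho_sin _ (hc _), rho_zero]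
  simp [-Complex.ofReal_sin, -Complex.ofReal_cos, Complex.conj_ofReal]
  ring

theorem sin_sq_add_cos_sq_ofReal (x : ℝ) :
    ((Real.sin x : ℝ) : ℂ) ^ 2 + ((Real.cos x : ℝ) : ℂ) ^ 2 = 1 := by
  exact_mod_cast Real.sin_sq_add_cos_sq x

theorem walkOp_mem_unitary (hc : ∀ c, 0 < Real.cos (angle θa θb c)) :
    walkOp θa θb ω ∈ unitary (HZ →L[ℂ] HZ) := by
  rw [Unitary.mem_iff, star_eq_adjoint]
  constructor
  · ext f n
    show adjoint (walkOp θa θb ω) (walkOp θa θb ω f) n = f n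
    rcases Int.even_or_odd' n with ⟨m, rfl | rfl⟩
    · obtain ⟨m, rfl⟩ : ∃ m', m = m' + 1 := ⟨m - 1, by ring⟩
      rw [show 2 * (m + 1) = 2 * m + 2 by ring, adjoint_walkOp_even hc, walkOp_even hc,
        walkOp_odd hc]
      linear_combination f (2 * m + 2) * sin_sq_add_cos_sq_ofReal (angle θa θb (ω m))
    · obtain ⟨m, rfl⟩ : ∃ m', m = m' - 1 := ⟨m + 1, by ring⟩
      rw [show 2 * (m - 1) + 1 = 2 * m - 1 by ring, adjoint_walkOp_odd hc, walkOp_even hc,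
        walkOp_odd hc]
      linear_combination f (2 * m - 1) * sin_sq_add_cos_sq_ofReal (angle θa θb (ω m))
  · ext f n
    show walkOp θa θb ω (adjoint (walkOp θa θb ω) f) n = f n
    rcases Int.even_or_odd' n with ⟨m, rfl | rfl⟩
    · rw [walkOp_even hc, adjoint_walkOp_even hc, adjoint_walkOp_odd hc]
      linear_combination f (2 * m) * sin_sq_add_cos_sq_ofReal (angle θa θb (ω m))
    · rw [walkOp_odd hc, adjoint_walkOp_even hc, adjoint_walkOp_odd hc]
      linear_combination f (2 * m + 1) * sin_sq_add_cos_sq_ofReal (angle θa θb (ω m))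

end Operator

/-! ### Lower bounds for normal operators -/

section Normal

open ContinuousLinearMap

variable {H : Type*} [NormedAddCommGroup H] [InnerProductSpace ℂ H] [CompleteSpace H]

theorem isStarNormal_algebraMap_sub {T : H →L[ℂ] H} (hT : IsStarNormal T) (z : ℂ) :
    IsStarNormal (algebraMap ℂ (H →L[ℂ] H) z - T) := by
  rw [isStarNormal_iff, Commute, SemiconjBy]
  have := hT.star_comm_self.eq
  have h2 := Algebra.commutes z (star T)
  have h3 := Algebra.commutes (star z) T
  simp only [star_sub, ← algebraMap_star_comm, sub_mul, mul_sub, this, h2, h3]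
  rw [← map_mul, ← map_mul, mul_comm]
  abel

theorem notMem_spectrum_of_forall_le_norm {T : H →L[ℂ] H} (hT : IsStarNormal T) {z : ℂ} {δ : ℝ}
    (hδ : 0 < δ) (h : ∀ f, δ * ‖f‖ ≤ ‖T f - z • f‖) : z ∉ spectrum ℂ T := by
  have hz : ∀ f, (algebraMap ℂ (H →L[ℂ] H) z - T) f = z • f - T f := fun f => by
    simp [Algebra.algebraMap_eq_smul_one]
  rw [spectrum.notMem_iff, isUnit_iff_bijective, bijective_iff_dense_range_and_antilipschitz]
  set S := algebraMap ℂ (H →L[ℂ] H) z - T with hS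
  have hSn : IsStarNormal S := isStarNormal_algebraMap_sub hT z
  have hle : ∀ f, δ * ‖f‖ ≤ ‖S f‖ := fun f => by rw [hz, norm_sub_rev]; exact h f
  refine ⟨?_, Real.toNNReal δ⁻¹, S.antilipschitz_of_bound fun f => ?_⟩
  · rw [Submodule.topologicalClosure_eq_top_iff, hSn.orthogonal_range, Submodule.eq_bot_iff]
    intro f hf
    have h0 : S f = 0 := hf
    have := hle f
    rw [h0, norm_zero] at this
    exact norm_le_zero_iff.1 (by nlinarith [norm_nonneg f])
  · rw [Real.coe_toNNReal _ (inv_pos.2 hδ).le, inv_mul_eq_div, le_div_iff₀ hδ, mul_comm]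
    exact hle f

/-- For a normal operator the distance of a point to the spectrum is a lower bound. -/
theorem forall_le_norm_of_spectrum {T : H →L[ℂ] H} (hT : IsStarNormal T) {z : ℂ} {δ : ℝ}
    (hδ : 0 < δ) (h : ∀ w ∈ spectrum ℂ T, δ ≤ ‖w - z‖) (f : H) : δ * ‖f‖ ≤ ‖T f - z • f‖ := by
  have hz : z ∉ spectrum ℂ T := fun hz => by simpa using (h z hz).trans_lt' hδ
  rw [spectrum.notMem_iff] at hz
  obtain ⟨u, hu⟩ := hz
  have hSn : IsStarNormal (u : H →L[ℂ] H) := hu ▸ isStarNormal_algebraMap_sub hT z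
  have hr : ‖((u⁻¹ : (H →L[ℂ] H)ˣ) : H →L[ℂ] H)‖ ≤ δ⁻¹ := by
    have h1 : spectralRadius ℂ ((u⁻¹ : (H →L[ℂ] H)ˣ) : H →L[ℂ] H) ≤ ENNReal.ofReal δ⁻¹ := by
      refine iSup₂_le fun r hr => ?_
      rw [← spectrum.inv₀_mem_iff, hu, ← spectrum.singleton_sub_eq] at hr
      obtain ⟨z', rfl, w, hw, hr⟩ := hr
      have h2 : δ ≤ ‖r‖⁻¹ := by
        rw [← norm_inv, ← hr, norm_sub_rev]; exact h w hw
      rw [← enorm_eq_nnnorm, ← ofReal_norm]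
      refine ENNReal.ofReal_le_ofReal ?_
      rw [← inv_inv ‖r‖]
      exact inv_anti₀ hδ h2
    rw [IsStarNormal.spectralRadius_eq_nnnorm] at h1
    have := ENNReal.toReal_mono ENNReal.ofReal_ne_top h1
    rwa [ENNReal.toReal_ofReal (inv_pos.2 hδ).le] at this
  have hf : ((u⁻¹ : (H →L[ℂ] H)ˣ) : H →L[ℂ] H) ((u : H →L[ℂ] H) f) = f := by
    rw [← mul_apply_eq_comp, u.inv_mul]; rfl
  have e : (u : H →L[ℂ] H) f = z • f - T f := by
    rw [hu]; simp [Algebra.algebraMap_eq_smul_one]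
  have := ContinuousLinearMap.le_of_opNorm_le _ hr ((u : H →L[ℂ] H) f)
  rw [hf, e, norm_sub_rev, inv_mul_eq_div, le_div_iff₀ hδ, mul_comm] at this
  exact this

end Normal

/-! ### Periodic walks -/

section Periodic

open ComplexConjugate

variable {θa θb : ℝ} {ω : ℤ → Letter} {z : ℂ}

/-- The word of length `p` seen in `ω` from position `m`. -/
def window (ω : ℤ → Letter) (m : ℤ) (p : ℕ) : List Letter := (List.range p).map fun i : ℕ => ω (m + i)

theorem window_succ (ω : ℤ → Letter) (m : ℤ) (p : ℕ) :
    window ω m (p + 1) = window ω m p ++ [ω (m + p)] := by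
  simp [window, List.range_succ]

theorem window_succ' (ω : ℤ → Letter) (m : ℤ) (p : ℕ) :
    window ω m (p + 1) = ω m :: window ω (m + 1) p := by
  simp only [window, List.range_succ_eq_map, List.map_cons, List.map_map, Function.comp_def]
  simp [add_comm, add_left_comm]

theorem window_add (ω : ℤ → Letter) (m : ℤ) (p q : ℕ) :
    window ω m (p + q) = window ω m p ++ window ω (m + p) q := by
  induction q with
  | zero => simp [window]
  | succ q ih => rw [← add_assoc, window_succ, ih, window_succ]; simp [add_assoc]

theorem window_congr {ω ω' : ℤ → Letter} {m m' : ℤ} {p : ℕ}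
    (h : ∀ i : ℕ, i < p → ω (m + i) = ω' (m' + i)) : window ω m p = window ω' m' p :=
  List.map_congr_left fun i hi => h i (List.mem_range.1 hi)

theorem length_window (ω : ℤ → Letter) (m : ℤ) (p : ℕ) : (window ω m p).length = p := by
  simp [window]

theorem trace_window_succ {m : ℤ} {p : ℕ} (h : ω (m + p) = ω m) :
    (wordMatrix θa θb z (window ω (m + 1) p)).trace = (wordMatrix θa θb z (window ω m p)).trace := by
  rcases p with _ | p
  · rfl
  · have e : ω (m + 1 + p) = ω m := by rw [← h]; congr 1; push_cast; ring
    rw [window_succ, window_succ', e, wordMatrix_append, Matrix.trace_mul_comm]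
    simp [wordMatrix]

theorem exists_norm_mulVec_le (A : Matrix (Fin 2) (Fin 2) ℂ) :
    ∃ K : ℝ, 0 ≤ K ∧ ∀ v, ‖A.mulVec v‖ ≤ K * ‖v‖ :=
  ⟨_, norm_nonneg _, (LinearMap.toContinuousLinearMap (Matrix.mulVecLin A)).le_opNorm⟩

theorem exists_norm_letterMatrix_le (θa θb : ℝ) (z : ℂ) :
    ∃ K : ℝ, 0 ≤ K ∧ ∀ c v, ‖(letterMatrix θa θb z c).mulVec v‖ ≤ K * ‖v‖ := by
  obtain ⟨K₁, h₁, h₁'⟩ := exists_norm_mulVec_le (letterMatrix θa θb z Letter.a)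
  obtain ⟨K₂, h₂, h₂'⟩ := exists_norm_mulVec_le (letterMatrix θa θb z Letter.b)
  refine ⟨max K₁ K₂, le_max_of_le_left h₁, fun c v => ?_⟩
  cases c
  · exact (h₁' v).trans (by gcongr; exact le_max_left _ _)
  · exact (h₂' v).trans (by gcongr; exact le_max_right _ _)

theorem exists_norm_wordMatrix_le (θa θb : ℝ) (z : ℂ) (p : ℕ) :
    ∃ K : ℝ, 0 ≤ K ∧ ∀ w : List Letter, w.length = p → ∀ v,
      ‖(wordMatrix θa θb z w).mulVec v‖ ≤ K * ‖v‖ := by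
  obtain ⟨K, hK, h⟩ := exists_norm_letterMatrix_le θa θb z
  refine ⟨K ^ p, by positivity, fun w hw v => ?_⟩
  induction w generalizing p v with
  | nil => subst hw; simp [wordMatrix]
  | cons c w ih =>
    subst hw
    rw [wordMatrix, ← Matrix.mulVec_mulVec, List.length_cons, pow_succ, mul_assoc]
    exact (ih _ rfl _).trans (by gcongr; exact h _ _)

/-- The two-component sequence of an element of `ℓ²(ℤ)` on which the matrices of the letters act,
up to an error, as long as the element is an approximate eigenvector. -/
noncomputable def pairAt (f : HZ) (m : ℤ) : Fin 2 → ℂ := ![f (2 * m), f (2 * m - 1)]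

theorem norm_pairAt_succ_sub_le (hz : ‖z‖ = 1) (hc : ∀ c, 0 < Real.cos (angle θa θb c)) (f : HZ)
    (m : ℤ) : ‖pairAt f (m + 1) - (letterMatrix θa θb z (ω m)).mulVec (pairAt f m)‖ ≤
      (1 + (Real.cos (angle θa θb (ω m)))⁻¹) * ∑ i ∈ Finset.range 2,
        ‖(walkOp θa θb ω f - z • f) (2 * m + (i : ℕ))‖ := by
  set g := walkOp θa θb ω f - z • f with hg
  have h1 : z * conj z = 1 := by rw [Complex.mul_conj', hz]; simp
  set c := Real.cos (angle θa θb (ω m)) with hcdef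
  set s := Real.sin (angle θa θb (ω m)) with hsdef
  have hcpos : 0 < c := hc _
  have hc0 : (c : ℂ) ≠ 0 := by exact_mod_cast hcpos.ne'
  have hsc : (s : ℂ) ^ 2 + (c : ℂ) ^ 2 = 1 := sin_sq_add_cos_sq_ofReal _
  have hs1 : |s| ≤ 1 := Real.abs_sin_le_one _
  have g0 : g (2 * m) = s * f (2 * m - 1) + c * f (2 * m + 2) - z * f (2 * m) := by
    rw [hg, lp.coeFn_sub, Pi.sub_apply, walkOp_even hc]; rfl
  have g1 : g (2 * m + 1) = c * f (2 * m - 1) - s * f (2 * m + 2) - z * f (2 * m + 1) := by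
    rw [hg, lp.coeFn_sub, Pi.sub_apply, walkOp_odd hc]; rfl
  have hM : letterMatrix θa θb z (ω m) = (c : ℂ)⁻¹ • !![z, -(s : ℂ); -(s : ℂ), conj z] := rfl
  have c0 : (pairAt f (m + 1) - (letterMatrix θa θb z (ω m)).mulVec (pairAt f m)) 0
      = (c : ℂ)⁻¹ * g (2 * m) := by
    rw [hM, g0]
    simp [pairAt, mul_add]
    field_simp
    ring
  have c1 : (pairAt f (m + 1) - (letterMatrix θa θb z (ω m)).mulVec (pairAt f m)) 1
      = -(conj z * s * (c : ℂ)⁻¹ * g (2 * m)) - conj z * g (2 * m + 1) := by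
    rw [hM, g0, g1]
    simp [pairAt, mul_add]
    rw [show 2 * m + 2 - 1 = 2 * m + 1 by ring]
    field_simp
    linear_combination -(c * f (2 * m + 1) + s * f (2 * m)) * h1 + conj z * f (2 * m - 1) * hsc
  have hsum : ∑ i ∈ Finset.range 2, ‖g (2 * m + (i : ℕ))‖ = ‖g (2 * m)‖ + ‖g (2 * m + 1)‖ := by
    simp [Finset.sum_range_succ]
  have hci : 0 < c⁻¹ := inv_pos.2 hcpos
  rw [hsum, pi_norm_le_iff_of_nonneg (by positivity)]
  have n0 := norm_nonneg (g (2 * m))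
  have n1 := norm_nonneg (g (2 * m + 1))
  intro i
  fin_cases i
  · show ‖(pairAt f (m + 1) - (letterMatrix θa θb z (ω m)).mulVec (pairAt f m)) 0‖ ≤ _
    rw [c0, norm_mul, norm_inv, Complex.norm_real, Real.norm_of_nonneg hcpos.le]
    nlinarith [mul_nonneg hci.le n1]
  · show ‖(pairAt f (m + 1) - (letterMatrix θa θb z (ω m)).mulVec (pairAt f m)) 1‖ ≤ _
    rw [c1]
    refine (norm_sub_le _ _).trans ?_
    rw [norm_neg, norm_mul, norm_mul, norm_mul, norm_mul, RCLike.norm_conj, hz, norm_inv,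
      Complex.norm_real, Complex.norm_real, Real.norm_of_nonneg hcpos.le, Real.norm_eq_abs]
    have : |s| * (c⁻¹ * ‖g (2 * m)‖) ≤ 1 * (c⁻¹ * ‖g (2 * m)‖) := by gcongr
    nlinarith [mul_nonneg hci.le n1]

theorem exists_norm_pairAt_add_sub_le (hz : ‖z‖ = 1) (hc : ∀ c, 0 < Real.cos (angle θa θb c))
    (ω : ℤ → Letter) (p : ℕ) : ∃ K : ℝ, 0 ≤ K ∧ ∀ (f : HZ) (m : ℤ),
      ‖pairAt f (m + p) - (wordMatrix θa θb z (window ω m p)).mulVec (pairAt f m)‖ ≤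
      K * ∑ i ∈ Finset.range (2 * p), ‖(walkOp θa θb ω f - z • f) (2 * m + (i : ℕ))‖ := by
  obtain ⟨K₁, hK₁, h₁⟩ := exists_norm_letterMatrix_le θa θb z
  obtain ⟨K₂, hK₂, h₂⟩ : ∃ K₂ : ℝ, 0 ≤ K₂ ∧ ∀ c, 1 + (Real.cos (angle θa θb c))⁻¹ ≤ K₂ := by
    have ha := inv_pos.2 (hc Letter.a)
    have hb := inv_pos.2 (hc Letter.b)
    refine ⟨1 + (Real.cos (angle θa θb Letter.a))⁻¹ + (Real.cos (angle θa θb Letter.b))⁻¹,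
      by positivity, fun c => ?_⟩
    cases c <;> linarith
  induction p with
  | zero => exact ⟨0, le_rfl, fun f m => by simp [window, wordMatrix]⟩
  | succ p ih =>
    obtain ⟨K, hK, h⟩ := ih
    refine ⟨K₁ * K + K₂, by positivity, fun f m => ?_⟩
    set g := walkOp θa θb ω f - z • f with hg
    have e1 := norm_pairAt_succ_sub_le (ω := ω) hz hc f (m + p)
    rw [← hg] at e1
    have e2 := h₁ (ω (m + p))
      (pairAt f (m + p) - (wordMatrix θa θb z (window ω m p)).mulVec (pairAt f m))
    have e3 := h f m
    rw [← hg] at e3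
    have split : ∑ i ∈ Finset.range (2 * (p + 1)), ‖g (2 * m + (i : ℕ))‖ =
        ∑ i ∈ Finset.range (2 * p), ‖g (2 * m + (i : ℕ))‖ +
        ∑ i ∈ Finset.range 2, ‖g (2 * (m + p) + (i : ℕ))‖ := by
      rw [mul_add, mul_one, Finset.sum_range_add]
      congr 1
      refine Finset.sum_congr rfl fun i _ => ?_
      rw [show 2 * m + ((2 * p + i : ℕ) : ℤ) = 2 * (m + p) + (i : ℤ) by push_cast; ring]
    have id : pairAt f (m + (p + 1 : ℕ)) -
        (wordMatrix θa θb z (window ω m (p + 1))).mulVec (pairAt f m) =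
        (pairAt f (m + p + 1) - (letterMatrix θa θb z (ω (m + p))).mulVec (pairAt f (m + p))) +
        (letterMatrix θa θb z (ω (m + p))).mulVec
          (pairAt f (m + p) - (wordMatrix θa θb z (window ω m p)).mulVec (pairAt f m)) := by
      rw [window_succ, wordMatrix_concat, Matrix.mulVec_sub, Matrix.mulVec_mulVec]
      push_cast
      rw [← add_assoc]; abel
    rw [id, split]
    refine (norm_add_le _ _).trans ((add_le_add (e1.trans (mul_le_mul_of_nonneg_right (h₂ _)
      (by positivity))) (e2.trans (mul_le_mul_of_nonneg_left e3 hK₁))).trans ?_)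
    set A := ∑ i ∈ Finset.range (2 * p), ‖g (2 * m + (i : ℕ))‖
    set B := ∑ i ∈ Finset.range 2, ‖g (2 * (m + p) + (i : ℕ))‖
    have hA : 0 ≤ A := by positivity
    have hB : 0 ≤ B := by positivity
    have : 0 ≤ K₂ * A + K₁ * K * B := by positivity
    linarith

/-- The translation `(S f)(n) = f (n + k)` of `ℓ²(ℤ)`. -/
noncomputable def shift (k : ℤ) : HZ →L[ℂ] HZ := diagShift (fun _ => 1) 1 (fun _ => by simp) k

theorem shift_apply (k : ℤ) (f : HZ) (n : ℤ) : shift k f n = f (n + k) := by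
  rw [shift, diagShift_apply, one_mul]

theorem norm_shift_le (k : ℤ) (f : HZ) : ‖shift k f‖ ≤ ‖f‖ := by
  have h : ‖shift k‖ ≤ 1 := by
    rw [shift, diagShift]
    exact LinearMap.mkContinuous_norm_le _ zero_le_one _
  simpa using (shift k).le_of_opNorm_le h f

theorem norm_le_of_forall_norm_le_sum {g h : HZ} {K : ℝ} (hK : 0 ≤ K) (s : Finset ℤ)
    (hh : ∀ n, ‖h n‖ ≤ K * ∑ i ∈ s, ‖g (n + i)‖) : ‖h‖ ≤ K * (s.card * ‖g‖) := by
  have hmem : Memℓp (fun n : ℤ => ((‖g n‖ : ℝ) : ℂ)) 2 := by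
    have h2 : (0 : ℝ) < (2 : ENNReal).toReal := by norm_num
    refine memℓp_gen ?_
    simpa using (memℓp_gen_iff h2).1 (lp.memℓp g)
  let G : HZ := ⟨_, hmem⟩
  have hG : ∀ n, G n = ((‖g n‖ : ℝ) : ℂ) := fun n => rfl
  have hGn : ‖G‖ ≤ ‖g‖ := lp.norm_mono two_ne_zero fun n => by rw [hG]; simp
  have h1 : ‖h‖ ≤ ‖(K : ℂ) • ∑ i ∈ s, shift i G‖ := by
    refine lp.norm_mono two_ne_zero fun n => (hh n).trans (le_of_eq ?_)
    have : ((K : ℂ) • ∑ i ∈ s, shift i G) n = ((K * ∑ i ∈ s, ‖g (n + i)‖ : ℝ) : ℂ) := by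
      rw [lp.coeFn_smul, Pi.smul_apply, lp.coeFn_sum, Finset.sum_apply]
      simp [shift_apply, hG]
    rw [this, Complex.norm_real, Real.norm_of_nonneg (by positivity)]
  refine h1.trans ?_
  rw [norm_smul, Complex.norm_real, Real.norm_of_nonneg hK]
  gcongr
  refine (norm_sum_le _ _).trans ?_
  rw [← nsmul_eq_mul]
  exact Finset.sum_le_card_nsmul _ _ _ fun i _ => (norm_shift_le _ _).trans hGn

/-- A periodic walk whose period has half-trace `x` with `|x| > 1` at `z` is bounded away
from `z`: up to an error controlled by `(U - z) f`, the theorem of Cayley and Hamilton gives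
`2 x f (n) = f (n + 2 p) + f (n - 2 p)`. -/
theorem exists_le_norm_walkOp_sub (hz : ‖z‖ = 1) (hc : ∀ c, 0 < Real.cos (angle θa θb c))
    {p : ℕ} (hp : ∀ m, ω (m + p) = ω m) {x : ℝ}
    (htr : ∀ m, (wordMatrix θa θb z (window ω m p)).trace = 2 * (x : ℂ)) (hx : 1 < |x|) :
    ∃ δ : ℝ, 0 < δ ∧ ∀ f : HZ, δ * ‖f‖ ≤ ‖walkOp θa θb ω f - z • f‖ := by
  obtain ⟨K₁, hK₁, h₁⟩ := exists_norm_pairAt_add_sub_le hz hc ω p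
  obtain ⟨K₂, hK₂, h₂⟩ := exists_norm_wordMatrix_le θa θb z p
  set K := K₁ + K₂ * K₁ + 2 * |x| * K₁ with hK
  have hK0 : 0 ≤ K := by positivity
  have main : ∀ (f : HZ) (m : ℤ),
      ‖pairAt f (m + p + p) - (2 * x : ℂ) • pairAt f (m + p) + pairAt f m‖ ≤
      K * ∑ i ∈ Finset.range (2 * p + 2 * p), ‖(walkOp θa θb ω f - z • f) (2 * m + (i : ℕ))‖ := by
    intro f m
    set g := walkOp θa θb ω f - z • f with hg
    have d1 := h₁ f m
    have d2 := h₁ f (m + p)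
    have hper : window ω (m + p) p = window ω m p :=
      window_congr fun i _ => by rw [show m + p + (i : ℤ) = m + i + p by ring, hp]
    rw [hper] at d2
    rw [← hg] at d1 d2
    set N := wordMatrix θa θb z (window ω m p) with hN
    set e₁ := pairAt f (m + p) - N.mulVec (pairAt f m) with he₁
    set e₂ := pairAt f (m + p + p) - N.mulVec (pairAt f (m + p)) with he₂
    have hNN : N * N = (2 * x : ℂ) • N - 1 := by
      rw [mul_self_of_det_eq_one (det_wordMatrix hz hc _), htr]
    have id : pairAt f (m + p + p) - (2 * x : ℂ) • pairAt f (m + p) + pairAt f m =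
        e₂ + N.mulVec e₁ - (2 * x : ℂ) • e₁ := by
      have hNN' : N.mulVec (N.mulVec (pairAt f m)) =
          (2 * x : ℂ) • N.mulVec (pairAt f m) - pairAt f m := by
        rw [Matrix.mulVec_mulVec, hNN, Matrix.sub_mulVec, Matrix.smul_mulVec, Matrix.one_mulVec]
      rw [he₁, he₂, Matrix.mulVec_sub, hNN', smul_sub]
      abel
    rw [id]
    have d3 := h₂ _ (length_window ω m p) e₁
    have split : ∑ i ∈ Finset.range (2 * p + 2 * p), ‖g (2 * m + (i : ℕ))‖ =
        ∑ i ∈ Finset.range (2 * p), ‖g (2 * m + (i : ℕ))‖ +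
        ∑ i ∈ Finset.range (2 * p), ‖g (2 * (m + p) + (i : ℕ))‖ := by
      rw [Finset.sum_range_add]
      congr 1
      refine Finset.sum_congr rfl fun i _ => ?_
      rw [show 2 * m + ((2 * p + i : ℕ) : ℤ) = 2 * (m + p) + (i : ℤ) by push_cast; ring]
    rw [split]
    set A := ∑ i ∈ Finset.range (2 * p), ‖g (2 * m + (i : ℕ))‖
    set B := ∑ i ∈ Finset.range (2 * p), ‖g (2 * (m + p) + (i : ℕ))‖
    have hA : 0 ≤ A := by positivity
    have hB : 0 ≤ B := by positivity
    calc ‖e₂ + N.mulVec e₁ - (2 * x : ℂ) • e₁‖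
        ≤ ‖e₂‖ + ‖N.mulVec e₁‖ + ‖(2 * x : ℂ) • e₁‖ :=
          (norm_sub_le _ _).trans (by gcongr; exact norm_add_le _ _)
      _ ≤ K₁ * B + K₂ * (K₁ * A) + 2 * |x| * (K₁ * A) := by
          have : ‖(2 * x : ℂ) • e₁‖ = 2 * |x| * ‖e₁‖ := by rw [norm_smul]; simp
          rw [this]
          gcongr
          exact d3.trans (by gcongr)
      _ ≤ K * (A + B) := by
          have : 0 ≤ K₁ * A + K₂ * K₁ * B + 2 * |x| * K₁ * B := by positivity
          rw [hK]; linarith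
  set s : Finset ℤ := Finset.Icc (-(2 * p : ℤ)) (2 * p) with hs
  have hKs : 0 < K * s.card + 1 := by positivity
  refine ⟨(2 * |x| - 2) / (K * s.card + 1), div_pos (by linarith) hKs, fun f => ?_⟩
  set g := walkOp θa θb ω f - z • f with hg
  set h : HZ := shift (2 * p) f - (2 * x : ℂ) • f + shift (-(2 * p)) f with hh
  have hhn : ∀ n, h n = f (n + 2 * p) - 2 * x * f n + f (n + -(2 * p)) := fun n => by
    rw [hh, lp.coeFn_add, lp.coeFn_sub, lp.coeFn_smul]
    simp [shift_apply]
  have bound : ‖h‖ ≤ K * (s.card * ‖g‖) := by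
    refine norm_le_of_forall_norm_le_sum hK0 s fun n => ?_
    -- a shift by one distinguishes the two components of the pairs
    have key : ∀ (d : ℤ) (m : ℤ), 0 ≤ d → d ≤ 1 → 2 * m = n - 2 * p + d →
        ∑ i ∈ Finset.range (2 * p + 2 * p), ‖g (2 * m + (i : ℕ))‖ ≤ ∑ i ∈ s, ‖g (n + i)‖ := by
      intro d m hd0 hd1 hm
      have inj : Set.InjOn (fun i : ℕ => -(2 * p : ℤ) + d + i) (Finset.range (2 * p + 2 * p)) :=
        fun a _ b _ hab => by simpa using hab
      calc ∑ i ∈ Finset.range (2 * p + 2 * p), ‖g (2 * m + (i : ℕ))‖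
          = ∑ i ∈ (Finset.range (2 * p + 2 * p)).image (fun i : ℕ => -(2 * p : ℤ) + d + i),
              ‖g (n + i)‖ := by
            rw [Finset.sum_image inj]
            refine Finset.sum_congr rfl fun i _ => ?_
            rw [show n + (-(2 * p : ℤ) + d + i) = 2 * m + i by rw [hm]; ring]
        _ ≤ ∑ i ∈ s, ‖g (n + i)‖ := by
            refine Finset.sum_le_sum_of_subset_of_nonneg ?_ fun _ _ _ => norm_nonneg _
            intro i hi
            simp only [Finset.mem_image, Finset.mem_range] at hi
            obtain ⟨j, hj, rfl⟩ := hi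
            rw [hs, Finset.mem_Icc]
            omega
    rcases Int.even_or_odd' n with ⟨k, rfl | rfl⟩
    · have h0 := (norm_le_pi_norm _ 0).trans (main f (k - p))
      refine le_trans (le_of_eq ?_) (h0.trans (mul_le_mul_of_nonneg_left
        (key 0 (k - p) le_rfl zero_le_one (by ring)) hK0))
      rw [hhn]
      simp only [pairAt, Pi.add_apply, Pi.sub_apply, Pi.smul_apply, Matrix.cons_val_zero,
        smul_eq_mul]
      ring_nf
    · have h0 := (norm_le_pi_norm _ 1).trans (main f (k + 1 - p))
      refine le_trans (le_of_eq ?_) (h0.trans (mul_le_mul_of_nonneg_left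
        (key 1 (k + 1 - p) zero_le_one le_rfl (by ring)) hK0))
      rw [hhn]
      simp only [pairAt, Pi.add_apply, Pi.sub_apply, Pi.smul_apply, Matrix.cons_val_one,
        Matrix.cons_val_fin_one, smul_eq_mul]
      ring_nf
  have tri : 2 * |x| * ‖f‖ ≤ 2 * ‖f‖ + ‖h‖ := by
    have e : (2 * x : ℂ) • f = shift (2 * p) f + shift (-(2 * p)) f - h := by rw [hh]; abel
    have e' : 2 * |x| * ‖f‖ = ‖(2 * x : ℂ) • f‖ := by rw [norm_smul]; simp
    rw [e', e]
    refine (norm_sub_le _ _).trans ?_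
    gcongr
    refine (norm_add_le _ _).trans ?_
    linarith [norm_shift_le (2 * p) f, norm_shift_le (-(2 * p)) f]
  rw [div_mul_eq_mul_div, div_le_iff₀ hKs]
  nlinarith [norm_nonneg g]

end Periodic

/-! ### Periodic approximants of the Fibonacci walk and the spectrum -/

section Approximants

variable {θa θb : ℝ} {ω : ℤ → Letter} {z : ℂ}

/-- The two-sided periodic sequence whose period is the word `S^j(b)`, translated by `c`. -/
def periodicWord (j : ℕ) (c : ℤ) (m : ℤ) : Letter := fibWord ((m + c) % (block j).length).toNat

theorem length_block_pos (j : ℕ) : 0 < (block j).length := by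
  rw [length_block]; exact Nat.fib_pos.2 (by omega)

theorem periodicWord_add_length (j : ℕ) (c m : ℤ) :
    periodicWord j c (m + (block j).length) = periodicWord j c m := by
  rw [periodicWord, periodicWord, add_right_comm, Int.add_emod_right]

theorem periodicWord_of_lt {j : ℕ} {c m : ℤ} {i : ℕ} (h : m + c = i)
    (hi : i < (block j).length) : periodicWord j c m = fibWord i := by
  rw [periodicWord, h, ← Int.natCast_mod, Int.toNat_natCast, Nat.mod_eq_of_lt hi]

theorem block_eq_map (j : ℕ) :
    block (j + 1) = (List.range (block (j + 1)).length).map fibWord := by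
  refine List.ext_getElem? fun i => ?_
  rcases lt_or_ge i (block (j + 1)).length with h | h
  · rw [block_getElem? j i h, List.getElem?_map, List.getElem?_range h]; rfl
  · rw [List.getElem?_eq_none h, List.getElem?_eq_none (by simpa using h)]

/-- All windows of one period have the same trace, being rotations of `S^j(b)`. -/
theorem trace_window_periodicWord {j : ℕ} (hj : 1 ≤ j) (c m : ℤ) :
    (wordMatrix θa θb z (window (periodicWord j c) m (block j).length)).trace =
      (wordMatrix θa θb z (block j)).trace := by
  have step : ∀ m, (wordMatrix θa θb z (window (periodicWord j c) (m + 1) (block j).length)).trace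
      = (wordMatrix θa θb z (window (periodicWord j c) m (block j).length)).trace :=
    fun m => trace_window_succ (periodicWord_add_length j c m)
  have all : ∀ k : ℤ,
      (wordMatrix θa θb z (window (periodicWord j c) (-c + k) (block j).length)).trace =
      (wordMatrix θa θb z (window (periodicWord j c) (-c) (block j).length)).trace := by
    intro k
    induction k with
    | zero => rw [add_zero]
    | succ k ih => rw [← add_assoc, step, ih]
    | pred k ih =>
      have := step (-c + (-k - 1))
      rw [show -c + (-(k : ℤ) - 1) + 1 = -c + -k by ring] at this
      rw [← this, ih]
  have base : window (periodicWord j c) (-c) (block j).length = block j := by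
    obtain ⟨j, rfl⟩ : ∃ j', j = j' + 1 := ⟨j - 1, by omega⟩
    conv_rhs => rw [block_eq_map]
    refine List.map_congr_left fun i hi => ?_
    exact periodicWord_of_lt (by ring) (List.mem_range.1 hi)
  have := all (m + c)
  rwa [base, show -c + (m + c) = m by ring] at this

theorem walkOp_congr (hc : ∀ c, 0 < Real.cos (angle θa θb c)) {ω' : ℤ → Letter} {N : ℤ} {f : HZ}
    (hf : ∀ n, N < |n| → f n = 0) (h : ∀ m, |m| ≤ N + 2 → ω m = ω' m) :
    walkOp θa θb ω f = walkOp θa θb ω' f := by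
  ext n
  obtain ⟨m, hm⟩ := Int.even_or_odd' n
  have hz : ¬ |m| ≤ N + 2 → f (2 * m - 1) = 0 ∧ f (2 * m + 2) = 0 := fun hm =>
    ⟨hf _ (by grind), hf _ (by grind)⟩
  rcases hm with rfl | rfl
  · rw [walkOp_even hc, walkOp_even hc]
    by_cases hm : |m| ≤ N + 2
    · rw [h m hm]
    · rw [(hz hm).1, (hz hm).2]; ring
  · rw [walkOp_odd hc, walkOp_odd hc]
    by_cases hm : |m| ≤ N + 2
    · rw [h m hm]
    · rw [(hz hm).1, (hz hm).2]; ring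

theorem isStarNormal_walkOp (hc : ∀ c, 0 < Real.cos (angle θa θb c)) :
    IsStarNormal (walkOp θa θb ω) := by
  have h := Unitary.mem_iff.1 (walkOp_mem_unitary (ω := ω) hc)
  exact ⟨by rw [Commute, SemiconjBy, h.1, h.2]⟩

theorem norm_eq_one_of_mem_spectrum (hc : ∀ c, 0 < Real.cos (angle θa θb c))
    (hz : z ∈ spectrum ℂ (walkOp θa θb ω)) : ‖z‖ = 1 := by
  simpa using spectrum.subset_circle_of_unitary (walkOp_mem_unitary hc) hz

theorem norm_eq_one_of_mem_spec (hc : ∀ c, 0 < Real.cos (angle θa θb c))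
    (hz : z ∈ spec θa θb) : ‖z‖ = 1 :=
  let ⟨_, _, h⟩ := hz; norm_eq_one_of_mem_spectrum hc h

theorem isOpen_escapes (hc : ∀ c, 0 < Real.cos (angle θa θb c)) (j : ℕ) :
    IsOpen {w : Metric.sphere (0 : ℂ) 1 | Escapes (fun n => halfTrace θa θb (w : ℂ) (block n)) j} := by
  have h : ∀ n, Continuous fun w : Metric.sphere (0 : ℂ) 1 => halfTrace θa θb (w : ℂ) (block n) :=
    fun n => continuous_halfTrace hc _
  exact (isOpen_lt continuous_const (h _).abs).inter
    ((isOpen_lt continuous_const (h _).abs).inter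
      (isOpen_lt (h _).abs ((h _).mul (h _)).abs))

/-- Escape is an open condition which is inherited by all later half-traces, so that the periodic
approximants keep a uniform distance from `z`. -/
theorem exists_le_norm_periodic (hz : ‖z‖ = 1) (hc : ∀ c, 0 < Real.cos (angle θa θb c)) {j : ℕ}
    (hj : Escapes (fun n => halfTrace θa θb z (block n)) j) :
    ∃ δ : ℝ, 0 < δ ∧ ∀ i, j ≤ i → ∀ (c : ℤ) (f : HZ),
      δ * ‖f‖ ≤ ‖walkOp θa θb (periodicWord (i + 1) c) f - z • f‖ := by
  obtain ⟨z₀, rfl⟩ : ∃ z₀ : Metric.sphere (0 : ℂ) 1, (z₀ : ℂ) = z :=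
    ⟨⟨z, mem_sphere_zero_iff_norm.2 hz⟩, rfl⟩
  obtain ⟨δ, hδ, hball⟩ := Metric.isOpen_iff.1 (isOpen_escapes hc j) z₀ hj
  refine ⟨δ, hδ, fun i hi c f => forall_le_norm_of_spectrum (isStarNormal_walkOp hc) hδ ?_ f⟩
  intro w hw
  by_contra! hlt
  have hw1 := norm_eq_one_of_mem_spectrum hc hw
  obtain ⟨w₀, rfl⟩ : ∃ w₀ : Metric.sphere (0 : ℂ) 1, (w₀ : ℂ) = w :=
    ⟨⟨w, mem_sphere_zero_iff_norm.2 hw1⟩, rfl⟩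
  have hmem : w₀ ∈ Metric.ball z₀ δ := by
    rw [Metric.mem_ball, Subtype.dist_eq, dist_eq_norm]; exact hlt
  have hesc : Escapes (fun n => halfTrace θa θb (w₀ : ℂ) (block n)) j := hball hmem
  have h1 := hesc.one_lt (halfTrace_block hw1 hc) hi
  obtain ⟨δ', hδ', hle⟩ := exists_le_norm_walkOp_sub hw1 hc
    (periodicWord_add_length (i + 1) c) (x := halfTrace θa θb (w₀ : ℂ) (block (i + 1)))
    (fun m => by rw [trace_window_periodicWord (by omega), trace_wordMatrix hw1 hc]) h1
  exact notMem_spectrum_of_forall_le_norm (isStarNormal_walkOp hc) hδ' hle hw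

/-- On the spectrum the half-traces do not escape: every finite window of `ω` is a window of all
later periodic approximants, whose lower bound therefore passes to `ω`. -/
theorem not_escapes_of_mem_spec (hc : ∀ c, 0 < Real.cos (angle θa θb c)) (hz : z ∈ spec θa θb)
    (j : ℕ) : ¬ Escapes (fun n => halfTrace θa θb z (block n)) j := by
  intro hj
  have hz1 := norm_eq_one_of_mem_spec hc hz
  obtain ⟨ω, hω, hzω⟩ := hz
  obtain ⟨δ, hδ, hper⟩ := exists_le_norm_periodic hz1 hc hj
  have hfin : ∀ (f : HZ) (N : ℕ), (∀ n : ℤ, (N : ℤ) < |n| → f n = 0) →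
      δ * ‖f‖ ≤ ‖walkOp θa θb ω f - z • f‖ := by
    intro f N hf
    obtain ⟨k, hk⟩ := hω (-(N + 2 : ℤ)) (2 * N + 5)
    set i := max j (k + (2 * N + 5)) with hi
    have hlen : k + (2 * N + 5) < (block (i + 1)).length := by
      rw [length_block]
      exact lt_of_le_of_lt (le_max_right _ _) (lt_fib_add_two i)
    have e : walkOp θa θb ω f = walkOp θa θb (periodicWord (i + 1) (k + N + 2)) f := by
      refine walkOp_congr hc hf fun m hm => ?_
      obtain ⟨hm1, hm2⟩ := abs_le.1 hm
      obtain ⟨t, ht⟩ := Int.eq_ofNat_of_zero_le (show 0 ≤ m + (N + 2) by omega)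
      have h1 := hk t (by omega)
      rw [show -(N + 2 : ℤ) + (t : ℤ) = m by omega] at h1
      rw [h1, periodicWord_of_lt (i := k + t) (by push_cast; omega) (by omega)]
    rw [e]
    exact hper i (le_max_left _ _) _ f
  refine notMem_spectrum_of_forall_le_norm (isStarNormal_walkOp hc) hδ (fun f => ?_) hzω
  have hsum := lp.hasSum_single (p := 2) (by norm_num) f
  refine le_of_tendsto_of_tendsto' ((continuous_norm.tendsto f |>.comp hsum).const_mul δ)
    (((walkOp θa θb ω - z • 1).continuous.norm.tendsto f).comp hsum) fun s => ?_
  refine hfin _ (∑ n ∈ s, n.natAbs) fun n hn => ?_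
  have hns : n ∉ s := fun h => by
    rw [Int.abs_eq_natAbs] at hn
    have : n.natAbs ≤ ∑ n ∈ s, n.natAbs := Finset.single_le_sum (f := fun n : ℤ => n.natAbs)
      (fun _ _ => Nat.zero_le _) h
    omega
  rw [lp.coeFn_sum, Finset.sum_apply]
  refine Finset.sum_eq_zero fun k hk => lp.single_apply_ne _ _ _ ?_
  rintro rfl
  exact hns hk

end Approximants

/-! ### Growth of the solutions -/

section Growth

variable {θa θb : ℝ} {ω : ℤ → Letter} {z : ℂ}

theorem map_verblunsky_range (m : ℕ) :
    (List.range (2 * m)).map (fun j : ℕ => verblunsky θa θb ω j)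
      = codeWord θa θb (window ω 0 m) := by
  induction m with
  | zero => rfl
  | succ m ih =>
    rw [window_succ, codeWord, List.flatMap_append, ← codeWord, ← ih, mul_add, mul_one,
      List.range_succ, List.range_succ]
    have h1 := verblunsky_even (θa := θa) (θb := θb) (ω := ω) m
    have h2 := verblunsky_odd (θa := θa) (θb := θb) (ω := ω) m
    simp [h1, h2, -Complex.ofReal_sin]

theorem transferN_two_mul (m : ℕ) : transferN θa θb ω z (2 * m)
    = transferWord z (codeWord θa θb (window ω 0 m)) := by
  have h : ∀ l : List ℕ, List.map (fun j : ℤ => verblunsky θa θb ω j) (l.flatMap fun n : ℕ => [(n : ℤ)])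
      = l.map fun j : ℕ => verblunsky θa θb ω j := fun l => by
    induction l with
    | nil => rfl
    | cons n l ih => rw [List.flatMap_cons, List.map_append, ih]; rfl
  rw [← map_verblunsky_range, ← h]
  rfl

theorem IsNormalizedSolution.norm_even (hz : ‖z‖ = 1) (hc : ∀ c, 0 < Real.cos (angle θa θb c))
    {ξ ζ : ℕ → ℂ} (h : IsNormalizedSolution θa θb ω z ξ ζ) (m : ℕ) :
    ‖ξ (2 * m)‖ = ‖(wordMatrix θa θb z (window ω 0 m)).mulVec ![ξ 0, ζ 0] 0‖ := by
  have h1 := congrFun (h.1 (2 * m)) 0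
  rw [transferN_two_mul, transferWord_codeWord hz hc, Matrix.smul_mulVec,
    Pi.smul_apply, smul_eq_mul] at h1
  rw [show ξ (2 * m) = ![ξ (2 * m), ζ (2 * m)] 0 from rfl, h1, norm_mul, norm_pow, hz, one_pow,
    one_mul]

/-- Where `ω` shows the square of a word with half-trace `x`, the value of a solution is
controlled by its values one and two periods later. -/
theorem IsNormalizedSolution.sq_le_of_square (hz : ‖z‖ = 1)
    (hc : ∀ c, 0 < Real.cos (angle θa θb c)) {ξ ζ : ℕ → ℂ}
    (h : IsNormalizedSolution θa θb ω z ξ ζ) {i p : ℕ} {x D : ℝ}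
    (hsq : window ω (i + p : ℕ) p = window ω i p)
    (htr : (wordMatrix θa θb z (window ω i p)).trace = 2 * (x : ℂ)) (hx : |x| ≤ D) :
    ‖ξ (2 * i)‖ ^ 2 ≤
      (4 * D ^ 2 + 1) * (‖ξ (2 * (i + p))‖ ^ 2 + ‖ξ (2 * (i + p + p))‖ ^ 2) := by
  rw [h.norm_even hz hc, h.norm_even hz hc, h.norm_even hz hc]
  set N := wordMatrix θa θb z (window ω i p) with hN
  set U := (wordMatrix θa θb z (window ω 0 i)).mulVec ![ξ 0, ζ 0] with hU
  have e1 : (wordMatrix θa θb z (window ω 0 (i + p))).mulVec ![ξ 0, ζ 0] = N.mulVec U := by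
    rw [window_add, wordMatrix_append, zero_add, Matrix.mulVec_mulVec]
  have e2 : (wordMatrix θa θb z (window ω 0 (i + p + p))).mulVec ![ξ 0, ζ 0] =
      (2 * x : ℂ) • N.mulVec U - U := by
    rw [window_add, wordMatrix_append, zero_add, ← Matrix.mulVec_mulVec, e1, hsq, ← hN,
      Matrix.mulVec_mulVec, mul_self_of_det_eq_one (det_wordMatrix hz hc _), htr,
      Matrix.sub_mulVec, Matrix.smul_mulVec, Matrix.one_mulVec]
  rw [e1, e2]
  set V := N.mulVec U
  have h1 : ‖U 0‖ ≤ 2 * |x| * ‖V 0‖ + ‖((2 * x : ℂ) • V - U) 0‖ := by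
    have : U 0 = (2 * x : ℂ) * V 0 - ((2 * x : ℂ) • V - U) 0 := by simp
    calc ‖U 0‖ ≤ ‖(2 * x : ℂ) * V 0‖ + ‖((2 * x : ℂ) • V - U) 0‖ := by
          conv_lhs => rw [this]
          exact norm_sub_le _ _
      _ = _ := by rw [norm_mul]; simp
  set A := ‖V 0‖
  set B := ‖((2 * x : ℂ) • V - U) 0‖
  have hA : 0 ≤ A := norm_nonneg _
  have hB : 0 ≤ B := norm_nonneg _
  have h2 : ‖U 0‖ ≤ 2 * D * A + B := h1.trans (by gcongr)
  calc ‖U 0‖ ^ 2 ≤ (2 * D * A + B) ^ 2 := by gcongr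
    _ ≤ (4 * D ^ 2 + 1) * (A ^ 2 + B ^ 2) := by nlinarith [sq_nonneg (2 * D * B - A)]

theorem sum_growth {a : ℕ → ℝ} (ha : ∀ n, 0 ≤ a n) {Q : ℝ} (hQ : 0 < Q) {N p N' : ℕ} (hNp : N ≤ p)
    (hN' : 2 * p + N ≤ N') (h : ∀ i < N, a i ≤ Q * (a (i + p) + a (i + p + p))) :
    (1 + 1 / Q) * ∑ i ∈ Finset.range N, a i ≤ ∑ i ∈ Finset.range N', a i := by
  have h1 : ∑ i ∈ Finset.range N, a i ≤
      Q * (∑ i ∈ Finset.range N, a (i + p) + ∑ i ∈ Finset.range N, a (i + p + p)) := by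
    rw [← Finset.sum_add_distrib, Finset.mul_sum]
    exact Finset.sum_le_sum fun i hi => h i (Finset.mem_range.1 hi)
  have shiftSum : ∀ k, N ≤ k → ∑ i ∈ Finset.range N, a i + ∑ i ∈ Finset.range N, a (i + k) ≤
      ∑ i ∈ Finset.range (k + N), a i := by
    intro k hk
    rw [Finset.sum_range_add]
    refine add_le_add (Finset.sum_le_sum_of_subset_of_nonneg (Finset.range_mono hk)
      fun _ _ _ => ha _) (le_of_eq (Finset.sum_congr rfl fun i _ => by rw [add_comm]))
  have h2 : ∑ i ∈ Finset.range N, a i + (∑ i ∈ Finset.range N, a (i + p) +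
      ∑ i ∈ Finset.range N, a (i + p + p)) ≤ ∑ i ∈ Finset.range N', a i := by
    calc _ ≤ ∑ i ∈ Finset.range (p + p), a i + ∑ i ∈ Finset.range N, a (p + p + i) := by
          rw [← add_assoc]
          refine add_le_add ((shiftSum p hNp).trans (Finset.sum_le_sum_of_subset_of_nonneg
            (Finset.range_mono (by omega)) fun _ _ _ => ha _))
            (le_of_eq (Finset.sum_congr rfl fun i _ => by congr 1; ring))
      _ = ∑ i ∈ Finset.range (p + p + N), a i := (Finset.sum_range_add _ _ _).symm
      _ ≤ _ := Finset.sum_le_sum_of_subset_of_nonneg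
            (Finset.range_mono (by omega)) fun _ _ _ => ha _
  rw [add_mul, one_mul, one_div, inv_mul_eq_div]
  have h3 := (div_le_iff₀' hQ).2 h1
  linarith

end Growth

/-! ### The power law -/

section MainEstimate

variable {θa θb : ℝ} {ω : ℤ → Letter} {z : ℂ}

theorem IsNormalizedSolution.mass_growth (hz : ‖z‖ = 1)
    (hc : ∀ c, 0 < Real.cos (angle θa θb c)) {ξ ζ : ℕ → ℂ} (hω : ω ∈ subshift)
    (h : IsNormalizedSolution θa θb ω z ξ ζ) {K : ℕ} (hK : 1 ≤ K) {D : ℝ}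
    (hD : ∀ j, K < j → |halfTrace θa θb z (block j)| ≤ D) :
    (1 + 1 / (4 * D ^ 2 + 1)) * ∑ m ∈ Finset.range ((block K).length - 2), ‖ξ (2 * m)‖ ^ 2 ≤
      ∑ m ∈ Finset.range ((block (K + 8)).length - 2), ‖ξ (2 * m)‖ ^ 2 := by
  obtain ⟨q, hq⟩ := hω 0 (3 * (block (K + 4)).length)
  obtain ⟨j, hj1, hj2, c, hwin⟩ := exists_square_window hK q
  have mono : ∀ {m n}, m ≤ n → (block m).length ≤ (block n).length := fun hmn => by
    rw [length_block, length_block]; exact Nat.fib_mono (by omega)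
  have mKj := mono (show K ≤ j by omega)
  have mj4 := mono hj2
  have mK4 := mono (show K ≤ K + 4 by omega)
  have hpos := length_block_pos K
  have r4 := length_block_succ_succ (K + 4)
  have r5 := length_block_succ_succ (K + 5)
  have r6 := length_block_succ_succ (K + 6)
  simp only [add_assoc, Nat.reduceAdd] at r4 r5 r6
  have m5 := mono (show K + 4 ≤ K + 5 by omega)
  have hω' : ∀ t < 2 * (block j).length + (block K).length - 2,
      ω (t : ℕ) = periodicWord j c (t : ℕ) := fun t ht => by
    have := hq t (by omega)
    rw [zero_add] at this
    rw [this, hwin t ht, periodicWord]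
    congr 1
    rw [add_comm c t, ← Nat.cast_add, ← Int.natCast_mod, Int.toNat_natCast]
  refine sum_growth (fun n => by positivity) (by positivity) (p := (block j).length) (by omega)
    (by omega) fun i hi => ?_
  have w1 : window ω i (block j).length = window (periodicWord j c) i (block j).length :=
    window_congr fun t ht => by exact_mod_cast hω' (i + t) (by omega)
  have w2 : window ω (i + (block j).length : ℕ) (block j).length
      = window (periodicWord j c) i (block j).length :=
    window_congr fun t ht => by
      have e := hω' (i + (block j).length + t) (by omega)
      rw [show ((i + (block j).length + t : ℕ) : ℤ) = (i + t : ℤ) + (block j).length by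
        push_cast; ring, periodicWord_add_length] at e
      rw [← e]; congr 1; push_cast; ring
  refine h.sq_le_of_square hz hc (w2.trans w1.symm) ?_ (hD j (by omega))
  rw [w1, trace_window_periodicWord (by omega), trace_wordMatrix hz hc]

theorem IsNormalizedSolution.pow_le_mass (hz : ‖z‖ = 1)
    (hc : ∀ c, 0 < Real.cos (angle θa θb c)) {ξ ζ : ℕ → ℂ} (hω : ω ∈ subshift)
    (h : IsNormalizedSolution θa θb ω z ξ ζ) {K : ℕ} (hK : 3 ≤ K) {D : ℝ}
    (hD : ∀ j, K < j → |halfTrace θa θb z (block j)| ≤ D) (n : ℕ) :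
    (1 + 1 / (4 * D ^ 2 + 1)) ^ n ≤
      ∑ m ∈ Finset.range ((block (K + 8 * n)).length - 2), ‖ξ (2 * m)‖ ^ 2 := by
  induction n with
  | zero =>
    have : 0 ∈ Finset.range ((block (K + 8 * 0)).length - 2) := by
      rw [Finset.mem_range, length_block]
      have : Nat.fib 4 ≤ Nat.fib (K + 8 * 0 + 1) := Nat.fib_mono (by omega)
      have h4 : Nat.fib 4 = 3 := rfl
      omega
    refine le_trans (le_of_eq ?_) (Finset.single_le_sum (f := fun m => ‖ξ (2 * m)‖ ^ 2)
      (fun _ _ => by positivity) this)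
    simp [h.2.1]
  | succ n ih =>
    have := h.mass_growth hz hc hω (K := K + 8 * n) (by omega) (fun j hj => hD j (by omega))
    rw [pow_succ']
    refine (mul_le_mul_of_nonneg_left ih (by positivity)).trans ?_
    rwa [mul_add, mul_one, ← add_assoc]

theorem mass_le_localNorm_sq (ξ : ℕ → ℂ) {L : ℝ} (hL : 0 ≤ L) :
    ∑ m ∈ Finset.range (⌊L⌋₊ / 2 + 1), ‖ξ (2 * m)‖ ^ 2 ≤ localNorm ξ L ^ 2 := by
  have h0 : 0 ≤ (L - ⌊L⌋₊) * ‖ξ (⌊L⌋₊ + 1)‖ ^ 2 :=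
    mul_nonneg (sub_nonneg.2 (Nat.floor_le hL)) (by positivity)
  rw [localNorm, Real.sq_sqrt (by positivity)]
  refine le_add_of_le_of_nonneg ?_ h0
  rw [← Finset.sum_image (f := fun n => ‖ξ n‖ ^ 2) (g := fun m : ℕ => 2 * m)
    (fun a _ b _ hab => by simpa using hab)]
  refine Finset.sum_le_sum_of_subset_of_nonneg (fun n hn => ?_) fun _ _ _ => by positivity
  simp only [Finset.mem_image, Finset.mem_range] at hn ⊢
  omega

theorem fib_le_goldenRatio_pow (n : ℕ) : (Nat.fib n : ℝ) ≤ Real.goldenRatio ^ n := by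
  induction n using Nat.twoStepInduction with
  | zero => simp
  | one => simpa using Real.one_lt_goldenRatio.le
  | more n h1 h2 =>
    rw [Nat.fib_add_two, pow_add, Real.goldenRatio_sq]
    push_cast
    rw [pow_succ] at h2
    linarith

/-- Half-traces which are eventually bounded by `D` force a power law with the same constants for
all solutions: over eight Fibonacci scales the mass at the even sites is multiplied by a factor of
at least `1 + 1 / (4 D² + 1)`. -/
theorem exists_const_le_localNorm (hz : ‖z‖ = 1) (hc : ∀ c, 0 < Real.cos (angle θa θb c))
    {K₀ : ℕ} {D Q γ : ℝ} (hQ : 4 * D ^ 2 + 1 ≤ Q)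
    (hD : ∀ j, K₀ ≤ j → |halfTrace θa θb z (block j)| ≤ D)
    (hγ : 16 * Real.log Real.goldenRatio * γ = Real.log (1 + 1 / Q)) :
    ∃ C₁ : ℝ, 0 < C₁ ∧ ∀ ω ∈ subshift, ∀ ξ ζ : ℕ → ℂ, IsNormalizedSolution θa θb ω z ξ ζ →
      ∀ L : ℝ, 1 ≤ L → C₁ * L ^ γ ≤ localNorm ξ L := by
  have hφ : 1 < Real.goldenRatio := Real.one_lt_goldenRatio
  have hφ0 := Real.goldenRatio_pos
  have hQ0 : 0 < Q := by nlinarith [sq_nonneg D]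
  set r := 1 + 1 / Q with hr
  have hr1 : 1 ≤ r := by rw [hr]; linarith [one_div_pos.2 hQ0]
  have hγ0 : 0 ≤ γ := by
    have h1 := Real.log_nonneg hr1
    have h2 := Real.log_pos hφ
    by_contra! hneg
    nlinarith
  set K := K₀ + 3 with hK
  set B := 2 * Real.goldenRatio ^ (K + 9) with hB
  have hB0 : 0 < B := by positivity
  refine ⟨(B ^ γ)⁻¹, by positivity, fun ω hω ξ ζ h L hL => ?_⟩
  have hL0 : 0 ≤ L := zero_le_one.trans hL
  set n := ⌊L⌋₊ / 2 + 1 with hn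
  -- the largest `m` for which the mass at scale `K + 8 m` is seen by `‖ξ‖_L`, or `m = 0`
  have hex : ∃ m, n < (block (K + 8 * (m + 1))).length - 2 := by
    refine ⟨n, ?_⟩
    have h1 := lt_fib_add_two (n + 2)
    have h2 : Nat.fib (n + 2 + 2) ≤ Nat.fib (K + 8 * (n + 1) + 1) := Nat.fib_mono (by omega)
    rw [length_block]
    omega
  classical
  set m := Nat.find hex with hm
  have hm1 : n < (block (K + 8 * (m + 1))).length - 2 := Nat.find_spec hex
  have hmass : r ^ m ≤ ∑ i ∈ Finset.range n, ‖ξ (2 * i)‖ ^ 2 := by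
    rcases Nat.eq_zero_or_pos m with h0 | h0
    · rw [h0, pow_zero]
      refine le_trans (le_of_eq ?_) (Finset.single_le_sum (f := fun m => ‖ξ (2 * m)‖ ^ 2)
        (fun _ _ => by positivity) (show 0 ∈ Finset.range n by simp [hn]))
      simp [h.2.1]
    · have h1 := Nat.find_min hex (show m - 1 < m by omega)
      rw [show m - 1 + 1 = m by omega, not_lt] at h1
      have h2 : r ≤ 1 + 1 / (4 * D ^ 2 + 1) := by rw [hr]; gcongr
      calc r ^ m ≤ (1 + 1 / (4 * D ^ 2 + 1)) ^ m := by gcongr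
        _ ≤ _ := h.pow_le_mass hz hc hω (K := K) (by omega) (fun j hj => hD j (by omega)) m
        _ ≤ _ := Finset.sum_le_sum_of_subset_of_nonneg (Finset.range_mono h1)
            fun _ _ _ => by positivity
  have hLB : L ≤ B * Real.goldenRatio ^ (8 * m) := by
    have h1 : L < ⌊L⌋₊ + 1 := Nat.lt_floor_add_one L
    have h2 : ⌊L⌋₊ + 1 ≤ 2 * Nat.fib (K + 8 * (m + 1) + 1) := by
      rw [length_block] at hm1; omega
    have h3 : ((⌊L⌋₊ + 1 : ℕ) : ℝ) ≤ 2 * Nat.fib (K + 8 * (m + 1) + 1) := by exact_mod_cast h2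
    have h4 := fib_le_goldenRatio_pow (K + 8 * (m + 1) + 1)
    have h5 : Real.goldenRatio ^ (K + 8 * (m + 1) + 1)
        = Real.goldenRatio ^ (K + 9) * Real.goldenRatio ^ (8 * m) := by
      rw [← pow_add]; congr 1; ring
    rw [h5] at h4
    push_cast at h3
    rw [hB]
    linarith
  have hpow : ((Real.goldenRatio ^ (8 * m)) ^ γ) ^ 2 = r ^ m := by
    have hl : Real.log (((Real.goldenRatio ^ (8 * m)) ^ γ) ^ 2) = Real.log (r ^ m) := by
      rw [Real.log_pow, Real.log_rpow (by positivity), Real.log_pow, Real.log_pow, ← hγ]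
      push_cast
      ring
    exact Real.log_injOn_pos (by simp only [Set.mem_Ioi]; positivity)
      (by simp only [Set.mem_Ioi]; positivity) hl
  have hmain : (Real.goldenRatio ^ (8 * m)) ^ γ ≤ localNorm ξ L := by
    refine le_of_sq_le_sq ?_ (Real.sqrt_nonneg _)
    rw [hpow]
    exact hmass.trans (mass_le_localNorm_sq ξ hL0)
  calc (B ^ γ)⁻¹ * L ^ γ ≤ (B ^ γ)⁻¹ * (B * Real.goldenRatio ^ (8 * m)) ^ γ := by gcongr
    _ = (Real.goldenRatio ^ (8 * m)) ^ γ := by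
        rw [Real.mul_rpow hB0.le (by positivity), inv_mul_cancel_left₀ (by positivity)]
    _ ≤ _ := hmain

end MainEstimate

end FibWalk

open FibWalk in
theorem mainTheorem9 (θa θb : ℝ)
    (ha : θa ∈ Set.Ioo (-(Real.pi / 2)) (Real.pi / 2))
    (hb : θb ∈ Set.Ioo (-(Real.pi / 2)) (Real.pi / 2))
    (z : ℂ) (hz : z ∈ FibWalk.spec θa θb) :
    ∃ C₁ : ℝ, 0 < C₁ ∧ ∀ ω ∈ FibWalk.subshift, ∀ ξ ζ : ℕ → ℂ,
      FibWalk.IsNormalizedSolution θa θb ω z ξ ζ →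
        ∀ L : ℝ, 1 ≤ L →
          C₁ * L ^ FibWalk.gammaOne θa θb z ≤ FibWalk.localNorm ξ L := by
  have hc : ∀ c, 0 < Real.cos (angle θa θb c) := fun c => by
    cases c
    · exact Real.cos_pos_of_mem_Ioo ha
    · exact Real.cos_pos_of_mem_Ioo hb
  have hz1 := norm_eq_one_of_mem_spec hc hz
  obtain ⟨K₀, hK₀⟩ := eventually_abs_le (y := fun n => halfTrace θa θb z (block n))
    (invariant_eq hz1 hc) (not_escapes_of_mem_spec hc hz)
  have hC : 3 / 2 + √(8 + invariant θa θb z) + 1 / 2 ≤ traceBound θa θb z :=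
    le_trans (by linarith) (le_max_left _ _)
  have hs := Real.sqrt_nonneg (8 + invariant θa θb z)
  have hlog := Real.log_pos Real.one_lt_goldenRatio
  refine exists_const_le_localNorm hz1 hc (D := 3 / 2 + √(8 + invariant θa θb z))
    (Q := 4 * traceBound θa θb z ^ 2) ?_ hK₀ ?_
  · nlinarith
  · rw [gammaOne]; field_simp
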